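/- Let $G$ be a finite, loopless, connected multigraph. A divisor is a function $D\colon V(G)\to\mathbb Z$, with degree $\deg(D)=\sum_v D(v)$; it is effective if $D\ge 0$. Two divisors $D,D'$ are linearly equivalent, $D\sim D'$, if $D-D'$ lies in the $\mathbb Z$-span of the columns of the Laplacian matrix of $G$. The Baker–Norine rank $r(D)$ is one less than the minimum of $\deg(E)$ over all effective divisors $E$ such that $D-E$ is not linearly equivalent to an effective divisor. A partial orientation $\mathcal O$ of $G$ is an orientation of a subset of the edges, and $D_{\mathcal O}(v)=\mathrm{indeg}_{\mathcal O}(v)-1$. It is acyclic if it has no directed cycle. An edge pivot at a vertex $v$ unorients an edge oriented towards $v$ and orients towards $v$ an unoriented edge incident to $v$. A cut reversal (respectively cycle reversal) reverses all edges of a cut all of whose edges are oriented, in the same direction across the cut (respectively all edges of a directed cycle). The generalized cocycle reversal system is the set of partial orientations modulo the equivalence relation generated by edge pivots and cut reversals; the generalized cycle-cocycle reversal system is the set of partial orientations modulo the equivalence relation generated by edge pivots, cut reversals and cycle reversals. Fix one of these two systems and write $[\mathcal O]$ for the class of $\mathcal O$ in it. For $k\in\mathbb Z$ let $\mathcal G_k$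 be the graph whose vertices are the classes $[\mathcal O]$ of the partial orientations with $\deg(D_{\mathcal O})=k$, where two distinct classes are adjacent if some representative of one is obtained from some representative of the other by reversing all edges of a directed path. Let $A$ be the set of vertices of $\mathcal G_k$ that contain an acyclic partial orientation, and let $d([\mathcal O],A)$ be the least length of a walk in $\mathcal G_k$ from $[\mathcal O]$ to an element of $A$. Theorem. Let $\mathcal O$ be a partial orientation of $G$ with $\deg(D_{\mathcal O})=k$. Then, for each of the two systems, $d([\mathcal O],A)$ is finite and $$r(D_{\mathcal O}) = d([\mathcal O],A)-1 .$$ -/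

import Mathlib

open scoped Graph

namespace ReversalSystem

variable {α β : Type*}

noncomputable section

/-! ### Divisors on a multigraph -/

/-- A divisor: an integer-valued function on the vertices. -/
abbrev Divisor (G : Graph α β) : Type _ := V(G) → ℤ

/-- The degree of a divisor. -/
def Divisor.deg {G : Graph α β} [Fintype V(G)] (D : Divisor G) : ℤ := ∑ v, D v

/-- The degree of a vertex: the number of edges incident to it. -/
def vdeg (G : Graph α β) (v : V(G)) : ℕ := {e : E(G) | G.Inc e v}.ncard

/-- The number of edges joining two vertices. -/
def edgeCount (G : Graph α β) (u v : V(G)) : ℕ := {e : E(G) | G.IsLink e u v}.ncard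

open Classical in
/-- The Laplacian matrix: the diagonal matrix of the vertex degrees minus the adjacency matrix. -/
def laplacian (G : Graph α β) : Matrix V(G) V(G) ℤ :=
  Matrix.diagonal (fun v => (vdeg G v : ℤ)) - Matrix.of fun u v => (edgeCount G u v : ℤ)

/-- Linear equivalence: the difference is an integer combination of the columns of the
Laplacian. -/
def LinEquiv {G : Graph α β} [Fintype V(G)] (D D' : Divisor G) : Prop :=
  ∃ f : V(G) → ℤ, D - D' = (laplacian G).mulVec f

/-- The Baker–Norine rank: one less than the least degree of an effective divisor `E` such that
`D - E` is not linearly equivalent to an effective divisor. -/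
def rank {G : Graph α β} [Fintype V(G)] (D : Divisor G) : ℤ :=
  sInf {n : ℤ | ∃ E : Divisor G, 0 ≤ E ∧ E.deg = n ∧
    ¬ ∃ E' : Divisor G, 0 ≤ E' ∧ LinEquiv (D - E) E'} - 1

/-! ### Partial orientations -/

/-- A partial orientation: each edge is either unoriented (`none`) or is assigned one of its ends
as its head. -/
structure PartialOrientation (G : Graph α β) where
  /-- The head of an edge, `none` if the edge is unoriented. -/
  head : E(G) → Option V(G)
  /-- The head of an edge is one of its ends. -/
  inc : ∀ e v, head e = some v → G.Inc e v

namespace PartialOrientation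

variable {G : Graph α β}

/-- The edge `e` is oriented from `u` to `v`. -/
def Arc (O : PartialOrientation G) (e : E(G)) (u v : V(G)) : Prop :=
  G.IsLink e u v ∧ O.head e = some v

/-- The number of edges oriented towards `v`. -/
def indeg (O : PartialOrientation G) (v : V(G)) : ℕ := {e : E(G) | O.head e = some v}.ncard

/-- The divisor of a partial orientation, `D_O(v) = indeg(v) - 1`. -/
def div (O : PartialOrientation G) : Divisor G := fun v => (O.indeg v : ℤ) - 1

/-- Directed walks: the head of each edge is the tail of its successor. -/
inductive DirWalk (O : PartialOrientation G) : V(G) → V(G) → Type _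
  | nil (u : V(G)) : DirWalk O u u
  | cons {u v w : V(G)} (e : E(G)) (h : O.Arc e u v) (p : DirWalk O v w) : DirWalk O u w

namespace DirWalk

/-- The list of vertices of a directed walk. -/
def support {O : PartialOrientation G} : {u v : V(G)} → O.DirWalk u v → List V(G)
  | _, _, nil u => [u]
  | u, _, cons _ _ p => u :: p.support

/-- The list of edges of a directed walk. -/
def edges {O : PartialOrientation G} : {u v : V(G)} → O.DirWalk u v → List E(G)
  | _, _, nil _ => []
  | _, _, cons e _ p => e :: p.edges

/-- A directed path: a directed walk without repeated vertices. -/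
def IsPath {O : PartialOrientation G} {u v : V(G)} (p : O.DirWalk u v) : Prop :=
  p.support.Nodup

/-- A directed cycle: a closed directed walk with at least one edge and without repeated vertices,
apart from the coincidence of its two ends. -/
def IsCycle {O : PartialOrientation G} {u : V(G)} (p : O.DirWalk u u) : Prop :=
  p.edges ≠ [] ∧ p.support.tail.Nodup

end DirWalk

/-- A partial orientation is acyclic if it has no directed cycle. -/
def Acyclic (O : PartialOrientation G) : Prop :=
  ∀ (u : V(G)) (p : O.DirWalk u u), ¬ p.IsCycle

/-- `O'` is obtained from `O` by reversing all edges in `S` (which have to be oriented). -/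
def IsReversal (O O' : PartialOrientation G) (S : Set E(G)) : Prop :=
  (∀ e ∈ S, ∃ u v, O.Arc e u v ∧ O'.Arc e v u) ∧ ∀ e ∉ S, O'.head e = O.head e

/-- The cut `(X, Xᶜ)`: the edges with one end in `X` and the other one outside `X`. -/
def cut (G : Graph α β) (X : Set V(G)) : Set E(G) :=
  {e | ∃ u v : V(G), u ∉ X ∧ v ∈ X ∧ G.IsLink e u v}

/-- An edge pivot at a vertex `v`: an edge `e` oriented towards `v` is unoriented, and an unoriented
edge `f` incident to `v` is oriented towards `v`. -/
def EdgePivot (O O' : PartialOrientation G) : Prop :=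
  ∃ (v : V(G)) (e f : E(G)), O.head e = some v ∧ O.head f = none ∧ G.Inc f v ∧
    O'.head e = none ∧ O'.head f = some v ∧ ∀ a, a ≠ e → a ≠ f → O'.head a = O.head a

/-- A cut reversal: each edge of the cut `(X, Xᶜ)` is oriented towards `X`, and all of these edges
are reversed. -/
def CutReversal (O O' : PartialOrientation G) : Prop :=
  ∃ X : Set V(G), (∀ e ∈ cut G X, ∃ v ∈ X, O.head e = some v) ∧ O.IsReversal O' (cut G X)

/-- A cycle reversal: all edges of a directed cycle are reversed. -/
def CycleReversal (O O' : PartialOrientation G) : Prop :=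
  ∃ (u : V(G)) (p : O.DirWalk u u), p.IsCycle ∧ O.IsReversal O' {e | e ∈ p.edges}

/-- A directed path reversal: all edges of a directed path are reversed. -/
def PathReversal (O O' : PartialOrientation G) : Prop :=
  ∃ (u v : V(G)) (p : O.DirWalk u v), p.IsPath ∧ O.IsReversal O' {e | e ∈ p.edges}

variable (G) in
/-- Equivalence in the generalized cocycle reversal system: generated by edge pivots and cut
reversals. -/
def cocycleSetoid : Setoid (PartialOrientation G) :=
  Relation.EqvGen.setoid fun O O' => EdgePivot O O' ∨ CutReversal O O'

variable (G) in
/-- Equivalence in the generalized cycle-cocycle reversal system: generated by edge pivots, cut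
reversals and cycle reversals. -/
def cycleCocycleSetoid : Setoid (PartialOrientation G) :=
  Relation.EqvGen.setoid fun O O' => EdgePivot O O' ∨ CutReversal O O' ∨ CycleReversal O O'

/-! ### The auxiliary graph -/

/-- The classes, for the equivalence `s`, of the partial orientations with associated divisor of
degree `k`. -/
def ClassOfDeg [Fintype V(G)] (s : Setoid (PartialOrientation G)) (k : ℤ) : Type _ :=
  {c : Quotient s // ∃ O : PartialOrientation G, O.div.deg = k ∧ Quotient.mk s O = c}

/-- The class `[O]`, as a vertex of the auxiliary graph. -/
def toClass [Fintype V(G)] (s : Setoid (PartialOrientation G)) {k : ℤ}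
    (O : PartialOrientation G) (hO : O.div.deg = k) : ClassOfDeg s k :=
  ⟨Quotient.mk s O, O, hO, rfl⟩

/-- The auxiliary graph: two distinct classes are adjacent if one of them has a representative from
which a directed path reversal leads to a representative of the other one. -/
def auxGraph [Fintype V(G)] (s : Setoid (PartialOrientation G)) (k : ℤ) :
    SimpleGraph (ClassOfDeg s k) :=
  SimpleGraph.fromRel fun c c' => ∃ O₁ O₂ : PartialOrientation G,
    Quotient.mk s O₁ = c.1 ∧ Quotient.mk s O₂ = c'.1 ∧ PathReversal O₁ O₂

/-- The set `A` of the classes that contain an acyclic partial orientation. -/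
def acyclicClasses [Fintype V(G)] (s : Setoid (PartialOrientation G)) (k : ℤ) :
    Set (ClassOfDeg s k) :=
  {c | ∃ O : PartialOrientation G, Quotient.mk s O = c.1 ∧ O.Acyclic}

end PartialOrientation

/-- The distance between two sets of vertices: the least length of a walk from one to the other
(infinite if there is none). -/
def setDist {V : Type*} (H : SimpleGraph V) (S T : Set V) : ℕ∞ :=
  ⨅ s ∈ S, ⨅ t ∈ T, H.edist s t

end

end ReversalSystem

namespace ReversalSystem

/-! ### The Laplacian -/

section Laplacian

variable {α β : Type*} {G : Graph α β}

/-! Rank and distance are compared through chip moves. Edge pivots and cycle reversals fix `D_O`, a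
cut reversal fires a set of vertices, and reversing a directed path from `u` to `v` moves one chip
from `v` to `u`. Hence the rank is constant on classes and changes by at most one along an edge of
the auxiliary graph (`rank_sub_one_le_rank_add_chip_sub_chip`). Acyclic orientations have rank -1
(`Acyclic.not_winnable`), so the distance to `A` is at least r + 1.

Conversely, while r ≥ 0, some neighbour has rank r - 1. Let `E ≥ 0` have degree r + 1 with `D - E`
unwinnable. Since deg D_O ≤ |E(G)| - |V(G)|, the divisor `D - E` has degree below that bound, and
then it stays unwinnable after a chip is added at a suitable `u` (`exists_not_winnable_add_chip`).
For `v` in the support of `E`, the divisor `E - v` now obstructs `D + u - v`.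

A path reversal realises this move: by Dhar's burning algorithm every class contains an acyclic or a
sourceless orientation (`exists_acyclic_or_div_nonneg`). If r ≥ 0 it is sourceless, and pivots and
cut reversals make every vertex reachable from `u` (`exists_reachable`). If r = -1, sourceless is
impossible and the class lies in `A`.

The argument only needs an equivalence between cocycle equivalence and linear equivalence of
divisors, so it serves both systems. -/

open Classical in
theorem natCast_ncard_eq_sum {ι : Type*} [Fintype ι] (s : Set ι) :
    (s.ncard : ℤ) = ∑ i, if i ∈ s then 1 else 0 := by
  rw [Set.ncard_eq_toFinset_card', Finset.sum_boole]
  congr 2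
  ext
  simp

/-- The number of edges joining `v` to a vertex of `T`. -/
noncomputable def edgesTo (G : Graph α β) (v : V(G)) (T : Set V(G)) : ℕ :=
  {e : E(G) | ∃ u ∈ T, G.IsLink e v u}.ncard

open Classical in
theorem edgesTo_eq_sum [Fintype V(G)] [Finite E(G)] (v : V(G)) (T : Set V(G)) :
    (edgesTo G v T : ℤ) = ∑ u, if u ∈ T then (edgeCount G v u : ℤ) else 0 := by
  have := Fintype.ofFinite E(G)
  simp_rw [edgesTo, edgeCount, natCast_ncard_eq_sum]
  have h (u : V(G)) : (if u ∈ T then ∑ e : E(G), (if e ∈ {e : E(G) | G.IsLink e v u} then (1 : ℤ)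
      else 0) else 0) = ∑ e : E(G), if u ∈ T ∧ G.IsLink e v u then 1 else 0 := by
    by_cases hu : u ∈ T <;> simp [hu]
  simp_rw [h]
  rw [Finset.sum_comm]
  refine Finset.sum_congr rfl fun e _ => ?_
  by_cases he : ∃ u ∈ T, G.IsLink e v u
  · obtain ⟨u, hu, hl⟩ := he
    rw [Set.mem_ofPred_eq, if_pos ⟨u, hu, hl⟩, Finset.sum_eq_single u, if_pos ⟨hu, hl⟩]
    · intro w _ hw
      exact if_neg fun hw' => hw (Subtype.ext (hw'.2.right_unique hl))
    · simp
  · rw [Set.mem_ofPred_eq, if_neg he, Finset.sum_eq_zero]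
    exact fun u _ => if_neg fun hu => he ⟨u, hu⟩

theorem vdeg_eq_edgesTo (v : V(G)) : vdeg G v = edgesTo G v Set.univ := by
  unfold vdeg edgesTo
  congr 1
  ext e
  exact ⟨fun ⟨y, hy⟩ => ⟨⟨y, hy.right_mem⟩, trivial, hy⟩, fun ⟨u, _, hu⟩ => ⟨u, hu⟩⟩

theorem edgeCount_comm (u v : V(G)) : edgeCount G u v = edgeCount G v u := by
  simp_rw [edgeCount, Graph.isLink_comm (x := (u : α))]

theorem laplacian_mulVec [Fintype V(G)] [Finite E(G)] (f : V(G) → ℤ) (v : V(G)) :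
    (laplacian G).mulVec f v = ∑ u, (edgeCount G v u : ℤ) * (f v - f u) := by
  classical
  rw [laplacian, Matrix.sub_mulVec, Pi.sub_apply, Matrix.mulVec_diagonal, vdeg_eq_edgesTo,
    edgesTo_eq_sum]
  simp [Matrix.mulVec, dotProduct, mul_sub, Finset.sum_sub_distrib, Finset.sum_mul]

open Classical in
-- Subtracting this vector from a divisor fires `X`: one chip crosses each edge of the cut, out of
-- `X`.
theorem laplacian_mulVec_indicator [Fintype V(G)] [Finite E(G)] (X : Set V(G)) (v : V(G)) :
    (laplacian G).mulVec (fun u => if u ∈ X then 1 else 0) v =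
      if v ∈ X then (edgesTo G v Xᶜ : ℤ) else -edgesTo G v X := by
  rw [laplacian_mulVec]
  by_cases hv : v ∈ X
  · simp only [hv, if_true, edgesTo_eq_sum]
    refine Finset.sum_congr rfl fun u _ => ?_
    by_cases hu : u ∈ X <;> simp [hu]
  · simp only [hv, if_false, edgesTo_eq_sum, ← Finset.sum_neg_distrib]
    refine Finset.sum_congr rfl fun u _ => ?_
    by_cases hu : u ∈ X <;> simp [hu]

theorem sum_laplacian_mulVec [Fintype V(G)] [Finite E(G)] (f : V(G) → ℤ) :
    ∑ v, (laplacian G).mulVec f v = 0 := by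
  have h : ∑ v, (laplacian G).mulVec f v = -∑ v, (laplacian G).mulVec f v := by
    simp_rw [laplacian_mulVec]
    conv_lhs => rw [Finset.sum_comm]
    simp_rw [← Finset.sum_neg_distrib]
    refine Finset.sum_congr rfl fun u _ => Finset.sum_congr rfl fun v _ => ?_
    rw [edgeCount_comm]
    ring
  omega

/-- At a vertex where `f` is maximal, the Laplacian of `f` is at least the number of edges leading
to vertices where `f` is not maximal. -/
theorem edgesTo_le_laplacian_mulVec [Fintype V(G)] [Finite E(G)] {f : V(G) → ℤ} {v : V(G)}
    (hv : ∀ w, f w ≤ f v) :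
    (edgesTo G v {w | f w < f v} : ℤ) ≤ (laplacian G).mulVec f v := by
  rw [laplacian_mulVec, edgesTo_eq_sum]
  refine Finset.sum_le_sum fun u _ => ?_
  have hc : (0 : ℤ) ≤ edgeCount G v u := by positivity
  split_ifs with hu
  · have hu : f u < f v := hu
    nlinarith
  · exact mul_nonneg hc (by linarith [hv u])

/-- In a connected graph there is a function whose Laplacian is positive at every vertex other
than `q`. -/
theorem exists_one_le_laplacian_mulVec [Fintype V(G)] [Finite E(G)] [G.Loopless]
    (hG : G.toSimpleGraph.Connected) (q : V(G)) :
    ∃ h : V(G) → ℤ, ∀ v ≠ q, 1 ≤ (laplacian G).mulVec h v := by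
  classical
  set d : V(G) → ℕ := fun v => G.toSimpleGraph.dist v q with hd
  -- The `+ 1` keeps every exponent `N - d v` positive, so the subtraction is never truncated and
  -- one more step away from `q` is still available.
  set N : ℕ := ∑ v, d v + 1 with hN
  set B : ℤ := ∑ v, (edgesTo G v Set.univ : ℤ) + 2 with hB
  have hdN (v : V(G)) : d v + 1 ≤ N := by
    have := Finset.single_le_sum (f := d) (fun _ _ => Nat.zero_le _) (Finset.mem_univ v)
    omega
  have hBv (v : V(G)) : (edgesTo G v Set.univ : ℤ) + 2 ≤ B := by
    have := Finset.single_le_sum (f := fun v => (edgesTo G v Set.univ : ℤ))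
      (fun _ _ => by positivity) (Finset.mem_univ v)
    omega
  have hB2 : 2 ≤ B := by have := hBv q; omega
  -- The function drops so steeply towards `q` that one neighbour closer to `q` outweighs all other
  -- neighbours.
  refine ⟨fun v => -B ^ (N - d v), fun v hv => ?_⟩
  obtain ⟨p, hp⟩ := hG.exists_walk_length_eq_dist v q
  obtain ⟨w, hvw, hw⟩ : ∃ w, G.toSimpleGraph.Adj v w ∧ d w + 1 = d v := by
    cases p with
    | nil => exact absurd rfl hv
    | cons h p' =>
      refine ⟨_, h, ?_⟩
      have h1 := SimpleGraph.dist_le p'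
      have h2 := (hG.dist_triangle (u := v) (w := q)).trans
        (Nat.add_le_add_right (SimpleGraph.dist_eq_one_iff_adj.2 h).le _)
      simp only [SimpleGraph.Walk.length_cons] at hp
      simp only [hd]
      omega
  obtain ⟨m, hm⟩ : ∃ m, N - d v = m + 1 := ⟨N - d v - 1, by have := hdN v; omega⟩
  have hwm : N - d w = m + 2 := by have := hdN w; omega
  have hP : (1 : ℤ) ≤ B ^ m := one_le_pow₀ (by omega)
  have hvw' : (1 : ℤ) ≤ edgeCount G v w := by
    obtain ⟨e, he⟩ := ((G.toSimpleGraph_adj_iff v w).1 hvw)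
    have : 0 < edgeCount G v w :=
      (Set.ncard_pos (Set.toFinite _)).2 ⟨⟨e, he.edge_mem⟩, he⟩
    exact_mod_cast this
  rw [laplacian_mulVec]
  have hterm (u : V(G)) : (edgeCount G v u : ℤ) * (if u = w then B ^ (m + 2) - B ^ (m + 1)
      else B ^ m - B ^ (m + 1)) ≤ edgeCount G v u * (-B ^ (N - d v) - -B ^ (N - d u)) := by
    by_cases huw : u = w
    · rw [if_pos huw, huw, hm, hwm]
      exact le_of_eq (by ring)
    · rw [if_neg huw]
      by_cases hc : edgeCount G v u = 0
      · simp [hc]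
      refine mul_le_mul_of_nonneg_left ?_ (by positivity)
      rw [hm]
      have hu : d u ≤ d v + 1 := by
        obtain ⟨e, he⟩ := (Set.ncard_pos (Set.toFinite _)).1 (Nat.pos_of_ne_zero hc)
        have hadj : G.toSimpleGraph.Adj u v :=
          (G.toSimpleGraph_adj_iff u v).2 ⟨e, Graph.IsLink.symm he⟩
        have := hG.dist_triangle (u := u) (v := v) (w := q)
        rw [SimpleGraph.dist_eq_one_iff_adj.2 hadj] at this
        simp only [hd]
        omega
      have : B ^ m ≤ B ^ (N - d u) := pow_le_pow_right₀ (by omega) (by omega)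
      linarith
  refine le_trans ?_ (Finset.sum_le_sum fun u _ => hterm u)
  have hsplit : ∑ u, (edgeCount G v u : ℤ) * (if u = w then B ^ (m + 2) - B ^ (m + 1)
      else B ^ m - B ^ (m + 1)) = edgesTo G v Set.univ * (B ^ m - B ^ (m + 1)) +
        edgeCount G v w * (B ^ (m + 2) - B ^ m) := by
    have hw' : edgeCount G v w * (B ^ (m + 2) - B ^ m) =
        ∑ u, if u = w then (edgeCount G v u : ℤ) * (B ^ (m + 2) - B ^ m) else 0 := by simp
    rw [edgesTo_eq_sum, Finset.sum_mul, hw', ← Finset.sum_add_distrib]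
    refine Finset.sum_congr rfl fun u _ => ?_
    simp only [Set.mem_univ, if_true]
    split_ifs <;> ring
  rw [hsplit]
  have h1 : (edgesTo G v Set.univ : ℤ) * (B ^ m - B ^ (m + 1)) =
      -(B ^ m * ((B - 1) * edgesTo G v Set.univ)) := by ring
  have h2 : B ^ (m + 2) - B ^ m = B ^ m * ((B - 1) * (B + 1)) := by ring
  have h3 : B ^ m * ((B - 1) * (B + 1)) ≤ (edgeCount G v w : ℤ) * (B ^ (m + 2) - B ^ m) := by
    rw [h2]
    exact le_mul_of_one_le_left (mul_nonneg (by linarith) (mul_nonneg (by linarith)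
      (by linarith))) hvw'
  have h4 : 1 ≤ B ^ m * ((B - 1) * (B + 1 - edgesTo G v Set.univ)) :=
    one_le_mul_of_one_le_of_one_le hP (one_le_mul_of_one_le_of_one_le (by linarith)
      (by linarith [hBv v]))
  rw [h1]
  linarith

/-- The functions which vanish at `q` and whose Laplacian is bounded above away from `q` have
uniformly bounded sums. -/
theorem exists_bound_of_laplacian_mulVec_le [Fintype V(G)] [Finite E(G)] [G.Loopless]
    (hG : G.toSimpleGraph.Connected) (q : V(G)) (D : V(G) → ℤ) :
    ∃ C : ℤ, ∀ f : V(G) → ℤ, f q = 0 → (∀ v ≠ q, (laplacian G).mulVec f v ≤ D v) →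
      ∑ v, f v ≤ C := by
  obtain ⟨h, hh⟩ := exists_one_le_laplacian_mulVec hG q
  set K : ℤ := ∑ v, |D v| + 1 with hK
  have hDK (v : V(G)) : D v < K := by
    have h1 := Finset.single_le_sum (f := fun v => |D v|) (fun _ _ => abs_nonneg _)
      (Finset.mem_univ v)
    have h2 := le_abs_self (D v)
    omega
  have hK0 : 0 ≤ K := by positivity
  refine ⟨∑ v, K * (h v - h q), fun f hfq hf => Finset.sum_le_sum fun v _ => ?_⟩
  have : Nonempty V(G) := ⟨q⟩
  -- Maximum principle: the Laplacian is nonnegative at a maximum, but that of `f - K • h` is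
  -- negative away from `q`.
  obtain ⟨w, hw⟩ := Finite.exists_max (f - K • h)
  have hwq : w = q := by
    by_contra hne
    have h1 := edgesTo_le_laplacian_mulVec hw
    have h6 : (laplacian G).mulVec (f - K • h) w =
        (laplacian G).mulVec f w - K * (laplacian G).mulVec h w := by
      rw [Matrix.mulVec_sub, Matrix.mulVec_smul]
      rfl
    have h2 := hh w hne
    have h3 := hf w hne
    have h4 := hDK w
    have h5 : K * 1 ≤ K * (laplacian G).mulVec h w := mul_le_mul_of_nonneg_left h2 hK0
    omega
  have := hw v
  simp only [hwq, Pi.sub_apply, Pi.smul_apply, smul_eq_mul, hfq] at this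
  linarith

end Laplacian

/-! ### Divisors -/

section Divisors

variable {α β : Type*} {G : Graph α β}

open Classical in
/-- The divisor with a single chip, at `u`. -/
noncomputable def chip (u : V(G)) : Divisor G := fun v => if v = u then 1 else 0

theorem chip_nonneg (u : V(G)) : 0 ≤ chip u := fun v => by
  unfold chip
  split_ifs <;> simp

variable [Fintype V(G)]

/-- A divisor is winnable if it is linearly equivalent to an effective divisor. -/
def Winnable (D : Divisor G) : Prop := ∃ E : Divisor G, 0 ≤ E ∧ LinEquiv D E

theorem LinEquiv.refl (D : Divisor G) : LinEquiv D D := ⟨0, by simp⟩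

theorem LinEquiv.symm {D D' : Divisor G} : LinEquiv D D' → LinEquiv D' D := by
  rintro ⟨f, hf⟩
  exact ⟨-f, by rw [Matrix.mulVec_neg, ← hf, neg_sub]⟩

theorem LinEquiv.trans {D₁ D₂ D₃ : Divisor G} :
    LinEquiv D₁ D₂ → LinEquiv D₂ D₃ → LinEquiv D₁ D₃ := by
  rintro ⟨f, hf⟩ ⟨g, hg⟩
  exact ⟨f + g, by rw [Matrix.mulVec_add, ← hf, ← hg, sub_add_sub_cancel]⟩

theorem LinEquiv.add_right {D D' : Divisor G} (h : LinEquiv D D') (F : Divisor G) :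
    LinEquiv (D + F) (D' + F) := by
  obtain ⟨f, hf⟩ := h
  exact ⟨f, by rw [← hf, add_sub_add_right_eq_sub]⟩

theorem LinEquiv.sub_right {D D' : Divisor G} (h : LinEquiv D D') (F : Divisor G) :
    LinEquiv (D - F) (D' - F) := by
  obtain ⟨f, hf⟩ := h
  exact ⟨f, by rw [← hf, sub_sub_sub_cancel_right]⟩

theorem LinEquiv.deg_eq [Finite E(G)] {D D' : Divisor G} (h : LinEquiv D D') :
    D.deg = D'.deg := by
  obtain ⟨f, hf⟩ := h
  have := sum_laplacian_mulVec f
  rw [← hf] at this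
  simp only [Pi.sub_apply, Finset.sum_sub_distrib] at this
  simp only [Divisor.deg]
  omega

theorem LinEquiv.winnable {D D' : Divisor G} (h : LinEquiv D D') (hD : Winnable D) :
    Winnable D' := by
  obtain ⟨E, hE, hDE⟩ := hD
  exact ⟨E, hE, h.symm.trans hDE⟩

theorem Winnable.add {D F : Divisor G} (hD : Winnable D) (hF : 0 ≤ F) : Winnable (D + F) := by
  obtain ⟨E, hE, hDE⟩ := hD
  exact ⟨E + F, add_nonneg hE hF, hDE.add_right F⟩

theorem Divisor.deg_add (D D' : Divisor G) : Divisor.deg (D + D') = D.deg + D'.deg :=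
  Finset.sum_add_distrib

theorem Divisor.deg_sub (D D' : Divisor G) : Divisor.deg (D - D') = D.deg - D'.deg :=
  Finset.sum_sub_distrib ..

theorem Divisor.deg_nonneg {D : Divisor G} (hD : 0 ≤ D) : 0 ≤ D.deg :=
  Finset.sum_nonneg fun v _ => hD v

theorem Winnable.deg_nonneg [Finite E(G)] {D : Divisor G} (hD : Winnable D) : 0 ≤ D.deg := by
  obtain ⟨E, hE, hDE⟩ := hD
  rw [hDE.deg_eq]
  exact Divisor.deg_nonneg hE

theorem deg_chip (u : V(G)) : (chip u).deg = 1 := by simp [Divisor.deg, chip]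

/-- If every nonempty set `M` of vertices contains a vertex with fewer chips than edges leaving
`M`, then the divisor is not winnable. -/
theorem not_winnable_of_forall_exists_lt [Finite E(G)] [Nonempty V(G)] {D : Divisor G}
    (h : ∀ M : Set V(G), M.Nonempty → ∃ v ∈ M, D v < edgesTo G v Mᶜ) : ¬ Winnable D := by
  rintro ⟨E, hE, f, hf⟩
  obtain ⟨w, hw⟩ := Finite.exists_max f
  -- Each vertex where `f` is maximal loses at least its edges leaving this set, so the `v` found
  -- here ends up in debt.
  obtain ⟨v, hv, hlt⟩ := h {v | ∀ u, f u ≤ f v} ⟨w, hw⟩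
  have h1 := edgesTo_le_laplacian_mulVec hv
  have h2 : ({u | f u < f v} : Set V(G)) = {v | ∀ u, f u ≤ f v}ᶜ := by
    ext u
    simp only [Set.mem_compl_iff, Set.mem_ofPred_eq, not_forall, not_le]
    exact ⟨fun hu => ⟨v, hu⟩, fun ⟨x, hx⟩ => hx.trans_le (hv x)⟩
  rw [h2, ← hf, Pi.sub_apply] at h1
  have h3 : (0 : ℤ) ≤ E v := hE v
  omega

/-- Existence of `q`-reduced divisors. -/
theorem exists_reduced [Finite E(G)] [G.Loopless] (hG : G.toSimpleGraph.Connected) (q : V(G))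
    (D : Divisor G) : ∃ D' : Divisor G, LinEquiv D D' ∧ (∀ v ≠ q, 0 ≤ D' v) ∧
      ∀ M : Set V(G), M.Nonempty → q ∉ M → ∃ v ∈ M, D' v < edgesTo G v Mᶜ := by
  classical
  obtain ⟨C, hC⟩ := exists_bound_of_laplacian_mulVec_le hG q D
  obtain ⟨h, hh⟩ := exists_one_le_laplacian_mulVec hG q
  -- Take a script of largest sum among those fixing `q` and leaving no debt elsewhere; firing
  -- another set that avoids `q` without creating debt would increase the sum.
  obtain ⟨z, ⟨f, hfq, hf, rfl⟩, hmax⟩ := Int.exists_greatest_of_bdd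
    (P := fun z => ∃ f : V(G) → ℤ, f q = 0 ∧ (∀ v ≠ q, (laplacian G).mulVec f v ≤ D v) ∧
      ∑ v, f v = z)
    ⟨C, by rintro z ⟨f, hfq, hf, rfl⟩; exact hC f hfq hf⟩ (by
      set K : ℤ := ∑ v, |D v|
      -- Such scripts exist: this one brings at least `K ≥ |D v|` chips to every `v ≠ q`.
      refine ⟨_, fun v => -K * (h v - h q), by simp, fun v hv => ?_, rfl⟩
      have h1 : (laplacian G).mulVec (fun v => -K * (h v - h q)) v =
          -K * (laplacian G).mulVec h v := by
        rw [laplacian_mulVec, laplacian_mulVec, Finset.mul_sum]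
        exact Finset.sum_congr rfl fun u _ => by ring
      have h2 := Finset.single_le_sum (f := fun v => |D v|) (fun _ _ => abs_nonneg _)
        (Finset.mem_univ v)
      have h3 := neg_abs_le (D v)
      have h4 : K * 1 ≤ K * (laplacian G).mulVec h v :=
        mul_le_mul_of_nonneg_left (hh v hv) (Finset.sum_nonneg fun _ _ => abs_nonneg _)
      rw [h1]
      change |D v| ≤ K at h2
      linarith)
  refine ⟨D - (laplacian G).mulVec f, ⟨f, sub_sub_cancel _ _⟩, fun v hv => ?_, fun M hM hqM => ?_⟩
  · rw [Pi.sub_apply]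
    linarith [hf v hv]
  by_contra! hcon
  have hfire := hmax _ ⟨f + fun u => if u ∈ M then (1 : ℤ) else 0, by simp [hfq, hqM],
    fun v hv => ?_, rfl⟩
  · simp only [Pi.add_apply, Finset.sum_add_distrib] at hfire
    obtain ⟨x, hx⟩ := hM
    have := Finset.single_le_sum (f := fun u => if u ∈ M then (1 : ℤ) else 0)
      (fun u _ => by split_ifs <;> simp) (Finset.mem_univ x)
    rw [if_pos hx] at this
    omega
  · rw [Matrix.mulVec_add, Pi.add_apply, laplacian_mulVec_indicator]
    split_ifs with hvM
    · have := hcon v hvM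
      rw [Pi.sub_apply] at this
      omega
    · have := hf v hv
      omega

/-- Burn the vertices one at a time, applying the hypothesis to the unburnt set. Orienting edges
from earlier to later vertices gives an acyclic orientation whose divisor dominates `D`. -/
theorem exists_order_of_forall_exists_lt {D : Divisor G}
    (h : ∀ M : Set V(G), M.Nonempty → ∃ v ∈ M, D v < edgesTo G v Mᶜ) :
    ∃ ν : V(G) → ℕ, ν.Injective ∧ ∀ v, D v < edgesTo G v {w | ν w < ν v} := by
  classical
  have key (n : ℕ) (hn : n ≤ Fintype.card V(G)) : ∃ (B : Finset V(G)) (ν : V(G) → ℕ),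
      B.card = n ∧ Set.InjOn ν B ∧
        ∀ v ∈ B, ν v < n ∧ D v < edgesTo G v {w | w ∈ B ∧ ν w < ν v} := by
    induction n with
    | zero => exact ⟨∅, 0, by simp⟩
    | succ n ih =>
      obtain ⟨B, ν, hB, hinj, hν⟩ := ih (by omega)
      have hne : ((B : Set V(G))ᶜ).Nonempty := by
        by_contra hemp
        rw [Set.not_nonempty_iff_eq_empty, Set.compl_empty_iff, Finset.coe_eq_univ] at hemp
        rw [hemp, Finset.card_univ] at hB
        omega
      obtain ⟨v, hvB, hv⟩ := h _ hne
      rw [Set.mem_compl_iff, Finset.mem_coe] at hvB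
      have hne' {w : V(G)} (hw : w ∈ B) : w ≠ v := fun hwv => hvB (hwv ▸ hw)
      refine ⟨insert v B, Function.update ν v n, by rw [Finset.card_insert_of_notMem hvB, hB],
        fun x hx y hy hxy => ?_, fun x hx => ?_⟩
      · rw [Finset.mem_coe, Finset.mem_insert] at hx hy
        rcases hx with rfl | hx <;> rcases hy with rfl | hy
        · rfl
        · rw [Function.update_self, Function.update_of_ne (hne' hy)] at hxy
          exact absurd hxy (hν y hy).1.ne'
        · rw [Function.update_self, Function.update_of_ne (hne' hx)] at hxy
          exact absurd hxy (hν x hx).1.ne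
        · rw [Function.update_of_ne (hne' hx), Function.update_of_ne (hne' hy)] at hxy
          exact hinj hx hy hxy
      · rw [Finset.mem_insert] at hx
        rcases hx with rfl | hx
        · rw [Function.update_self]
          refine ⟨Nat.lt_succ_self n, ?_⟩
          convert hv using 3
          ext w
          rw [compl_compl, Set.mem_ofPred_eq, Finset.mem_insert, Finset.mem_coe]
          constructor
          · rintro ⟨rfl | hw, hlt⟩
            · rw [Function.update_self] at hlt
              omega
            · exact hw
          · intro hw
            rw [Function.update_of_ne (hne' hw)]
            exact ⟨Or.inr hw, (hν w hw).1⟩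
        · rw [Function.update_of_ne (hne' hx)]
          refine ⟨(hν x hx).1.trans (Nat.lt_succ_self n), ?_⟩
          convert (hν x hx).2 using 3
          ext w
          rw [Set.mem_ofPred_eq, Set.mem_ofPred_eq, Finset.mem_insert]
          constructor
          · rintro ⟨rfl | hw, hlt⟩
            · rw [Function.update_self] at hlt
              exact absurd hlt (hν x hx).1.not_gt
            · rw [Function.update_of_ne (hne' hw)] at hlt
              exact ⟨hw, hlt⟩
          · rintro ⟨hw, hlt⟩
            rw [Function.update_of_ne (hne' hw)]
            exact ⟨Or.inr hw, hlt⟩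
  obtain ⟨B, ν, hB, hinj, hν⟩ := key _ le_rfl
  rw [Finset.card_eq_iff_eq_univ] at hB
  subst hB
  exact ⟨ν, by simpa using hinj, fun v => by simpa using (hν v (Finset.mem_univ v)).2⟩

/-- Each edge is counted once, at its later end. -/
theorem sum_edgesTo_lt [Finite E(G)] [G.Loopless] {ν : V(G) → ℕ} (hν : ν.Injective) :
    ∑ v, (edgesTo G v {w | ν w < ν v} : ℤ) = Nat.card E(G) := by
  classical
  have := Fintype.ofFinite E(G)
  simp_rw [edgesTo, natCast_ncard_eq_sum]
  rw [Finset.sum_comm, Nat.card_eq_fintype_card, ← Finset.card_univ, Finset.cast_card]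
  refine Finset.sum_congr rfl fun e _ => ?_
  obtain ⟨x, y, hlt, hxy⟩ : ∃ x y : V(G), ν y < ν x ∧ G.IsLink e x y := by
    obtain ⟨x, y, hxy⟩ := Graph.exists_isLink_of_mem_edgeSet e.2
    have hne : (⟨x, hxy.left_mem⟩ : V(G)) ≠ ⟨y, hxy.right_mem⟩ :=
      fun h => hxy.ne (congrArg Subtype.val h)
    rcases (hν.ne hne).lt_or_gt with h | h
    · exact ⟨_, _, h, hxy.symm⟩
    · exact ⟨_, _, h, hxy⟩
  rw [Finset.sum_eq_single x]
  · exact if_pos ⟨y, hlt, hxy⟩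
  · rintro z - hzx
    refine if_neg ?_
    rintro ⟨u, hu, hzu⟩
    rcases hzu.eq_and_eq_or_eq_and_eq hxy with ⟨h1, h2⟩ | ⟨h1, h2⟩
    · exact hzx (Subtype.ext h1)
    · rw [Subtype.ext h1, Subtype.ext h2] at hu
      exact hlt.not_gt hu
  · simp

/-- The reduced divisor lies below the divisor of an acyclic orientation, which has degree |E(G)| -
|V(G)|. A smaller degree leaves slack at some vertex, where a chip fits without losing the
domination. -/
theorem exists_not_winnable_add_chip [Finite E(G)] [G.Loopless]
    (hG : G.toSimpleGraph.Connected) {D : Divisor G} (hD : ¬ Winnable D)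
    (hdeg : D.deg < Nat.card E(G) - Fintype.card V(G)) : ∃ u, ¬ Winnable (D + chip u) := by
  classical
  have := hG.nonempty
  obtain ⟨q⟩ := this
  have : Nonempty V(G) := ⟨q⟩
  obtain ⟨D', hDD', hD', hred⟩ := exists_reduced hG q D
  have hq : D' q < 0 := by
    by_contra! hq
    refine hD ⟨D', fun v => ?_, hDD'⟩
    by_cases hv : v = q
    · rw [hv]; exact hq
    · exact hD' v hv
  obtain ⟨ν, hν, hlt⟩ := exists_order_of_forall_exists_lt (D := D') fun M hM => by
    by_cases hqM : q ∈ M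
    · exact ⟨q, hqM, by omega⟩
    · exact hred M hM hqM
  obtain ⟨u, hu⟩ : ∃ u, D' u + 1 < edgesTo G u {w | ν w < ν u} := by
    by_contra! hcon
    have h1 := Finset.sum_le_sum fun v (_ : v ∈ Finset.univ) => hcon v
    rw [sum_edgesTo_lt hν, Finset.sum_add_distrib] at h1
    have h2 := hDD'.deg_eq
    simp only [Divisor.deg, Finset.sum_const, Finset.card_univ, nsmul_eq_mul, mul_one] at *
    omega
  refine ⟨u, fun hwin => ?_⟩
  refine not_winnable_of_forall_exists_lt (D := D' + chip u) (fun M hM => ?_)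
    ((hDD'.add_right _).winnable hwin)
  -- All edges from the earliest vertex of `M` to earlier vertices leave `M`.
  obtain ⟨v, hvM, hv⟩ := Set.exists_min_image M ν (Set.toFinite M) hM
  have hsub : edgesTo G v {w | ν w < ν v} ≤ edgesTo G v Mᶜ := by
    refine Set.ncard_le_ncard ?_ (Set.toFinite _)
    rintro e ⟨w, hw, hl⟩
    exact ⟨w, fun hwM => (hv w hwM).not_gt hw, hl⟩
  refine ⟨v, hvM, ?_⟩
  have h1 := hlt v
  simp only [Pi.add_apply, chip]
  split_ifs with hvu
  · subst hvu
    omega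
  · omega

/-! ### The rank -/

theorem exists_deg_eq_rank_add_one [Finite E(G)] [Nonempty V(G)] (D : Divisor G) :
    ∃ E : Divisor G, 0 ≤ E ∧ E.deg = rank D + 1 ∧ ¬ Winnable (D - E) := by
  obtain ⟨q⟩ := ‹Nonempty V(G)›
  -- The infimum is attained, not a default value: `|D| + chip q` has degree above `deg D`, and all
  -- degrees in the set are nonnegative.
  have := Int.csInf_mem (s := {n : ℤ | ∃ E : Divisor G, 0 ≤ E ∧ E.deg = n ∧
    ¬ ∃ E' : Divisor G, 0 ≤ E' ∧ LinEquiv (D - E) E'}) ⟨_, (fun v => |D v|) + chip q,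
      add_nonneg (fun v => abs_nonneg _) (chip_nonneg q), rfl, fun hwin => ?_⟩
      ⟨0, by rintro n ⟨E, hE, rfl, -⟩; exact Divisor.deg_nonneg hE⟩
  · obtain ⟨E, hE, hdeg, hw⟩ := this
    exact ⟨E, hE, by rw [hdeg, rank, sub_add_cancel], hw⟩
  · have h1 := Winnable.deg_nonneg hwin
    rw [Divisor.deg_sub, Divisor.deg_add, deg_chip] at h1
    have h2 : D.deg ≤ Divisor.deg (fun v => |D v|) :=
      Finset.sum_le_sum fun v _ => le_abs_self _
    omega

theorem rank_add_one_le_deg {D E : Divisor G} (hE : 0 ≤ E) (h : ¬ Winnable (D - E)) :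
    rank D + 1 ≤ E.deg := by
  rw [rank, sub_add_cancel]
  exact csInf_le ⟨0, by rintro n ⟨E, hE, rfl, -⟩; exact Divisor.deg_nonneg hE⟩ ⟨E, hE, rfl, h⟩

theorem LinEquiv.rank_eq [Finite E(G)] [Nonempty V(G)] {D D' : Divisor G} (h : LinEquiv D D') :
    rank D = rank D' := by
  obtain ⟨E, hE, hdeg, hw⟩ := exists_deg_eq_rank_add_one D
  obtain ⟨E', hE', hdeg', hw'⟩ := exists_deg_eq_rank_add_one D'
  have h1 := rank_add_one_le_deg hE fun hwin => hw ((h.symm.sub_right E).winnable hwin)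
  have h2 := rank_add_one_le_deg hE' fun hwin => hw' ((h.sub_right E').winnable hwin)
  omega

theorem neg_one_le_rank [Finite E(G)] [Nonempty V(G)] (D : Divisor G) : -1 ≤ rank D := by
  obtain ⟨E, hE, hdeg, -⟩ := exists_deg_eq_rank_add_one D
  have := Divisor.deg_nonneg hE
  omega

theorem rank_eq_neg_one_iff [Finite E(G)] [Nonempty V(G)] {D : Divisor G} :
    rank D = -1 ↔ ¬ Winnable D := by
  constructor
  · intro h hwin
    obtain ⟨E, hE, hdeg, hw⟩ := exists_deg_eq_rank_add_one D
    rw [h, neg_add_cancel, Divisor.deg, Finset.sum_eq_zero_iff_of_nonneg fun v _ => hE v] at hdeg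
    have hE0 : E = 0 := funext fun v => hdeg v (Finset.mem_univ v)
    rw [hE0, sub_zero] at hw
    exact hw hwin
  · intro h
    have h1 := rank_add_one_le_deg (D := D) (E := 0) le_rfl (by rwa [sub_zero])
    have h2 := neg_one_le_rank D
    simp only [Divisor.deg, Pi.zero_apply, Finset.sum_const_zero] at h1
    omega

/-- If `E` obstructs `D + u - v`, then `E + v` obstructs `D`, since adding a chip preserves
winnability. -/
theorem rank_sub_one_le_rank_add_chip_sub_chip [Finite E(G)] [Nonempty V(G)] (D : Divisor G)
    (u v : V(G)) : rank D - 1 ≤ rank (D + chip u - chip v) := by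
  obtain ⟨E, hE, hdeg, hw⟩ := exists_deg_eq_rank_add_one (D + chip u - chip v)
  have := rank_add_one_le_deg (D := D) (add_nonneg hE (chip_nonneg v)) fun hwin =>
    hw (by
      have := hwin.add (chip_nonneg u)
      rwa [show D - (E + chip v) + chip u = D + chip u - chip v - E by abel] at this)
  rw [Divisor.deg_add, deg_chip] at this
  omega

/-- With `E` a minimal obstruction for `D` and `v` in its support, `D + u - v - (E - v)` equals `D -
E + u`, so it suffices to add a chip to `D - E` without making it winnable. -/
theorem exists_rank_add_chip_sub_chip [Finite E(G)] [G.Loopless]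
    (hG : G.toSimpleGraph.Connected) {D : Divisor G} (hD : 0 ≤ rank D)
    (hdeg : D.deg ≤ Nat.card E(G) - Fintype.card V(G)) :
    ∃ u v, rank (D + chip u - chip v) = rank D - 1 := by
  have := hG.nonempty
  obtain ⟨E, hE, hEdeg, hw⟩ := exists_deg_eq_rank_add_one D
  obtain ⟨v, hv⟩ : ∃ v, 0 < E v := by
    by_contra! hcon
    have : E.deg ≤ 0 := Finset.sum_nonpos fun v _ => hcon v
    omega
  obtain ⟨u, hu⟩ := exists_not_winnable_add_chip hG hw (by rw [Divisor.deg_sub]; omega)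
  have hE' : 0 ≤ E - chip v := fun w => by
    have h1 : (0 : ℤ) ≤ E w := hE w
    simp only [Pi.zero_apply, Pi.sub_apply, chip]
    split_ifs with hwv
    · subst hwv
      omega
    · omega
  have h1 := rank_add_one_le_deg (D := D + chip u - chip v) hE' fun hwin => hu (by
    rwa [show D + chip u - chip v - (E - chip v) = D - E + chip u by abel] at hwin)
  have h2 := rank_sub_one_le_rank_add_chip_sub_chip D u v
  rw [Divisor.deg_sub, deg_chip] at h1
  exact ⟨u, v, by omega⟩

end Divisors

namespace PartialOrientation

variable {α β : Type*} {G : Graph α β} {O O' : PartialOrientation G}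

/-! ### Directed walks -/

theorem exists_arc_of_head_eq {e : E(G)} {v : V(G)} (h : O.head e = some v) :
    ∃ u, O.Arc e u v := by
  obtain ⟨y, hy⟩ := O.inc e v h
  exact ⟨⟨y, hy.right_mem⟩, hy.symm, h⟩

theorem Arc.tail_eq {e : E(G)} {u u' v v' : V(G)} (h : O.Arc e u v) (h' : G.IsLink e u' v')
    (hv : v' = v) : u' = u := by
  subst hv
  exact Subtype.ext (h'.left_unique h.1)

namespace DirWalk

theorem support_eq_cons {u v : V(G)} (p : O.DirWalk u v) : p.support = u :: p.support.tail := by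
  cases p <;> rfl

theorem map_head_edges {u v : V(G)} (p : O.DirWalk u v) :
    p.edges.map O.head = p.support.tail.map some := by
  induction p with
  | nil u => rfl
  | cons e h p ih =>
    rw [edges, support, List.map_cons, ih, h.2, List.tail_cons, p.support_eq_cons]
    rfl

/-- Distinct heads force distinct edges. Only the tail of the support matters, so cycles are covered
as well as paths. -/
theorem nodup_edges {u v : V(G)} {p : O.DirWalk u v} (hp : p.support.tail.Nodup) :
    p.edges.Nodup := by
  refine List.Nodup.of_map O.head ?_
  rw [map_head_edges]
  exact hp.map (Option.some_injective _)

theorem exists_arc_of_mem_edges {u v : V(G)} {p : O.DirWalk u v} {e : E(G)} (he : e ∈ p.edges) :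
    ∃ a b, O.Arc e a b := by
  induction p with
  | nil u => simp [edges] at he
  | cons e' h p ih =>
    rw [edges, List.mem_cons] at he
    rcases he with rfl | he
    · exact ⟨_, _, h⟩
    · exact ih he

theorem exists_prefix {u w c : V(G)} (p : O.DirWalk u w) (hc : c ∈ p.support) :
    ∃ p' : O.DirWalk u c, p'.support <+: p.support := by
  induction p with
  | nil u =>
    rw [support, List.mem_singleton] at hc
    subst hc
    exact ⟨nil c, List.prefix_rfl⟩
  | @cons u v w e h p ih =>
    rw [support, List.mem_cons] at hc
    rcases hc with rfl | hc
    · exact ⟨nil c, by simp [support]⟩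
    · obtain ⟨p', hp'⟩ := ih hc
      exact ⟨cons e h p', by simpa [support] using hp'⟩

theorem exists_suffix {u w c : V(G)} (p : O.DirWalk u w) (hc : c ∈ p.support) :
    ∃ p' : O.DirWalk c w, p'.support <:+ p.support := by
  induction p with
  | nil u =>
    rw [support, List.mem_singleton] at hc
    subst hc
    exact ⟨nil c, List.suffix_rfl⟩
  | @cons u v w e h p ih =>
    rw [support, List.mem_cons] at hc
    rcases hc with rfl | hc
    · exact ⟨cons e h p, List.suffix_rfl⟩
    · obtain ⟨p', hp'⟩ := ih hc
      exact ⟨p', hp'.trans (List.suffix_cons _ _)⟩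

theorem exists_isPath_of_reflTransGen {u v : V(G)}
    (h : Relation.ReflTransGen (fun a b => ∃ e, O.Arc e a b) u v) :
    ∃ p : O.DirWalk u v, p.IsPath := by
  induction h using Relation.ReflTransGen.head_induction_on with
  | refl => exact ⟨nil v, List.nodup_singleton v⟩
  | @head a b hab _ ih =>
    obtain ⟨e, he⟩ := hab
    obtain ⟨p, hp⟩ := ih
    by_cases ha : a ∈ p.support
    · obtain ⟨p', hp'⟩ := p.exists_suffix ha
      exact ⟨p', hp.sublist hp'.sublist⟩
    · exact ⟨cons e he p, List.nodup_cons.2 ⟨ha, hp⟩⟩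

theorem lt_of_forall_arc_lt {ν : V(G) → ℕ} (h : ∀ e u v, O.Arc e u v → ν u < ν v) {u v : V(G)}
    (p : O.DirWalk u v) : p.edges ≠ [] → ν u < ν v := by
  have hle {u v : V(G)} (p : O.DirWalk u v) : ν u ≤ ν v := by
    induction p with
    | nil u => exact le_rfl
    | cons e he p ih => exact (h _ _ _ he).le.trans ih
  cases p with
  | nil u => exact fun hne => absurd rfl hne
  | cons e he p => exact fun _ => (h _ _ _ he).trans_le (hle p)

end DirWalk

theorem acyclic_of_forall_arc_lt {ν : V(G) → ℕ} (h : ∀ e u v, O.Arc e u v → ν u < ν v) :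
    O.Acyclic :=
  fun _ p hp => (p.lt_of_forall_arc_lt h hp.1).false

/-- Otherwise a directed path could be extended backwards inside `M` forever: meeting an old vertex
would close a cycle. -/
theorem Acyclic.exists_forall_not_arc [Finite V(G)] (h : O.Acyclic) {M : Set V(G)}
    (hM : M.Nonempty) : ∃ v ∈ M, ∀ e, ∀ u ∈ M, ¬ O.Arc e u v := by
  by_contra! hcon
  have := Fintype.ofFinite V(G)
  have key (n : ℕ) : ∃ (u w : V(G)) (p : O.DirWalk u w), p.IsPath ∧ u ∈ M ∧
      p.support.length = n + 1 := by
    induction n with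
    | zero =>
      obtain ⟨x, hx⟩ := hM
      exact ⟨x, x, DirWalk.nil x, List.nodup_singleton x, hx, rfl⟩
    | succ n ih =>
      obtain ⟨u, w, p, hp, huM, hlen⟩ := ih
      obtain ⟨e, c, hcM, he⟩ := hcon u huM
      have hc : c ∉ p.support := fun hc => by
        obtain ⟨p', hp'⟩ := p.exists_prefix hc
        exact h c (DirWalk.cons e he p') ⟨by simp [DirWalk.edges], hp.sublist hp'.sublist⟩
      exact ⟨c, w, DirWalk.cons e he p, List.nodup_cons.2 ⟨hc, hp⟩, hcM, by
        rw [DirWalk.support, List.length_cons, hlen]⟩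
  obtain ⟨u, w, p, hp, -, hlen⟩ := key (Fintype.card V(G))
  have := List.Nodup.length_le_card hp
  omega

/-! ### The divisor of a partial orientation -/

theorem div_nonneg_iff [Finite E(G)] {v : V(G)} : 0 ≤ O.div v ↔ ∃ e, O.head e = some v := by
  have h : 0 < O.indeg v ↔ ∃ e, O.head e = some v := Set.ncard_pos (Set.toFinite _)
  rw [← h, div]
  omega

theorem neg_one_le_div (v : V(G)) : -1 ≤ O.div v := by
  rw [div]
  omega

theorem deg_div_le [Fintype V(G)] [Finite E(G)] :
    O.div.deg ≤ Nat.card E(G) - Fintype.card V(G) := by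
  classical
  have := Fintype.ofFinite E(G)
  have h : ∑ v, (O.indeg v : ℤ) ≤ Nat.card E(G) := by
    simp_rw [indeg, natCast_ncard_eq_sum]
    rw [Finset.sum_comm, Nat.card_eq_fintype_card, ← Finset.card_univ, Finset.cast_card]
    refine Finset.sum_le_sum fun e _ => ?_
    rcases he : O.head e with - | x
    · simp [he]
    · simp [he]
  simp only [Divisor.deg, div, Finset.sum_sub_distrib, Finset.sum_const, Finset.card_univ,
    nsmul_eq_mul, mul_one]
  omega

/-- At a vertex that is a source within `M`, all incoming edges come from outside `M`, and the
divisor is one less than their number. -/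
theorem Acyclic.not_winnable [Fintype V(G)] [Finite E(G)] [Nonempty V(G)] (h : O.Acyclic) :
    ¬ Winnable O.div := by
  refine not_winnable_of_forall_exists_lt fun M hM => ?_
  obtain ⟨v, hvM, hv⟩ := h.exists_forall_not_arc hM
  have hle : O.indeg v ≤ edgesTo G v Mᶜ := by
    refine Set.ncard_le_ncard (fun e he => ?_) (Set.toFinite _)
    obtain ⟨u, hu⟩ := exists_arc_of_head_eq he
    exact ⟨u, fun huM => hv e u huM hu, hu.1.symm⟩
  refine ⟨v, hvM, ?_⟩
  rw [div]
  omega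

/-! ### Effect of the moves on the divisor -/

theorem EdgePivot.div_eq [Finite E(G)] (h : EdgePivot O O') : O'.div = O.div := by
  obtain ⟨v, e, f, he, hf, -, he', hf', hother⟩ := h
  funext w
  have hef : f ≠ e := by
    rintro rfl
    rw [he] at hf
    cases hf
  suffices hw : O'.indeg w = O.indeg w by rw [div, div, hw]
  by_cases hwv : w = v
  · subst hwv
    have : {a | O'.head a = some w} = insert f ({a | O.head a = some w} \ {e}) := by
      ext a
      by_cases hae : a = e
      · subst hae
        simp [he', hef.symm]
      by_cases haf : a = f
      · subst haf
        simp [hf']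
      simp [hother a hae haf, hae, haf]
    rw [indeg, this]
    exact Set.ncard_exchange (by simp [hf]) he
  · unfold indeg
    congr 1
    ext a
    by_cases hae : a = e
    · subst hae
      simp [he, he', Ne.symm hwv]
    by_cases haf : a = f
    · subst haf
      simp [hf, hf', Ne.symm hwv]
    simp [hother a hae haf]

open Classical in
theorem div_eq_of_isReversal_cut [Fintype V(G)] [Finite E(G)] {X : Set V(G)}
    (hX : ∀ e ∈ cut G X, ∃ v ∈ X, O.head e = some v) (h : O.IsReversal O' (cut G X)) :
    O'.div = O.div - (laplacian G).mulVec (fun v => if v ∈ X then 1 else 0) := by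
  have hhead {e : E(G)} {u v : V(G)} (hu : u ∉ X) (hv : v ∈ X) (he : G.IsLink e u v) :
      O.head e = some v ∧ O'.head e = some u := by
    have hcut : e ∈ cut G X := ⟨u, v, hu, hv, he⟩
    obtain ⟨x, hx, hex⟩ := hX e hcut
    obtain ⟨a, b, hab, hba⟩ := h.1 e hcut
    have hbx : b = x := by simpa [hab.2] using hex
    subst hbx
    rcases he.eq_and_eq_or_eq_and_eq hab.1 with ⟨h1, h2⟩ | ⟨h1, h2⟩
    · rw [Subtype.ext h1, Subtype.ext h2]
      exact ⟨hab.2, hba.2⟩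
    · exact absurd (Subtype.ext h1 ▸ hx) hu
  funext v
  rw [Pi.sub_apply, laplacian_mulVec_indicator]
  split_ifs with hv
  · suffices hs : O'.indeg v + edgesTo G v Xᶜ = O.indeg v by
      rw [div, div]
      omega
    have hsub : {e : E(G) | ∃ u ∈ Xᶜ, G.IsLink e v u} ⊆ {e | O.head e = some v} := by
      rintro e ⟨u, hu, he⟩
      exact (hhead hu hv he.symm).1
    rw [indeg, indeg, edgesTo, ← Set.ncard_sdiff_add_ncard_of_subset hsub (Set.toFinite _)]
    congr 2
    ext e
    by_cases he : ∃ u ∈ Xᶜ, G.IsLink e v u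
    · obtain ⟨u, hu, hl⟩ := he
      have hne : u ≠ v := fun huv => hu (huv ▸ hv)
      simp only [Set.mem_ofPred_eq, Set.mem_sdiff, (hhead hu hv hl.symm).2, Option.some.injEq, hne,
        false_iff, not_and, not_not]
      exact fun _ => ⟨u, hu, hl⟩
    · by_cases hcut : e ∈ cut G X
      · obtain ⟨a, b, ha, hb, hab⟩ := hcut
        have h1 : a ≠ v := fun hav => ha (hav ▸ hv)
        have h2 : b ≠ v := fun hbv => he ⟨a, ha, hbv ▸ hab.symm⟩
        simp [(hhead ha hb hab).1, (hhead ha hb hab).2, h1, h2]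
      · simp only [Set.mem_ofPred_eq, Set.mem_sdiff, h.2 e hcut, he, not_false_eq_true, and_true]
  · suffices hs : O'.indeg v = O.indeg v + edgesTo G v X by
      rw [div, div]
      omega
    have hdisj : Disjoint {e | O.head e = some v} {e : E(G) | ∃ u ∈ X, G.IsLink e v u} := by
      rw [Set.disjoint_left]
      rintro e he ⟨u, hu, hl⟩
      have h1 := (hhead hv hu hl).1
      rw [show O.head e = some v from he, Option.some.injEq] at h1
      exact hv (h1 ▸ hu)
    rw [indeg, indeg, edgesTo, ← Set.ncard_union_eq hdisj (Set.toFinite _) (Set.toFinite _)]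
    congr 1
    ext e
    by_cases he : ∃ u ∈ X, G.IsLink e v u
    · obtain ⟨u, hu, hl⟩ := he
      simp only [Set.mem_ofPred_eq, Set.mem_union, (hhead hv hu hl).2, true_iff]
      exact Or.inr ⟨u, hu, hl⟩
    · by_cases hcut : e ∈ cut G X
      · obtain ⟨a, b, ha, hb, hab⟩ := hcut
        have h1 : b ≠ v := fun hbv => hv (hbv ▸ hb)
        have h2 : a ≠ v := fun hav => he ⟨b, hb, hav ▸ hab⟩
        simp only [Set.mem_ofPred_eq, Set.mem_union, (hhead ha hb hab).1, (hhead ha hb hab).2,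
          Option.some.injEq, h1, h2, he, or_self]
      · simp only [Set.mem_ofPred_eq, Set.mem_union, h.2 e hcut, he, or_false]

open Classical in
-- Reversing an arc moves a chip from its head to its tail; along a walk these changes telescope.
theorem sum_map_edges_of_isReversal {S : Set E(G)} (h : O.IsReversal O' S) (x : V(G))
    {u v : V(G)} (p : O.DirWalk u v) (hp : ∀ e ∈ p.edges, e ∈ S) :
    (p.edges.map fun e => (if O'.head e = some x then (1 : ℤ) else 0) -
      if O.head e = some x then 1 else 0).sum = chip u x - chip v x := by
  induction p with
  | nil u => simp [DirWalk.edges]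
  | @cons u v w e he p ih =>
    rw [DirWalk.edges, List.map_cons, List.sum_cons,
      ih fun e' he' => hp e' (List.mem_cons_of_mem _ he')]
    obtain ⟨a, b, hab, hba⟩ := h.1 e (hp e List.mem_cons_self)
    have hbv : b = v := by simpa [hab.2] using he.2
    have hau : a = u := he.tail_eq hab.1 hbv
    rw [he.2, hba.2, hau]
    simp only [chip, Option.some.injEq, eq_comm (a := x)]
    ring

theorem div_eq_of_isReversal_edges [Finite E(G)] {u v : V(G)} {p : O.DirWalk u v}
    (hp : p.support.tail.Nodup) (h : O.IsReversal O' {e | e ∈ p.edges}) :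
    O'.div = O.div + chip u - chip v := by
  classical
  have := Fintype.ofFinite E(G)
  funext x
  have h1 := sum_map_edges_of_isReversal h x p fun _ he => he
  rw [← List.sum_toFinset _ (DirWalk.nodup_edges hp), Finset.sum_subset (Finset.subset_univ _),
    Finset.sum_sub_distrib] at h1
  · have h2 (O : PartialOrientation G) :
        (O.indeg x : ℤ) = ∑ e, if O.head e = some x then 1 else 0 := by
      rw [indeg, natCast_ncard_eq_sum]
      exact Finset.sum_congr rfl fun e _ => by
        by_cases he : O.head e = some x <;> simp [he]
    rw [← h2, ← h2] at h1
    simp only [div, Pi.sub_apply, Pi.add_apply]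
    omega
  · intro e _ he
    rw [List.mem_toFinset] at he
    rw [h.2 e he, sub_self]

theorem CycleReversal.div_eq [Finite E(G)] (h : CycleReversal O O') : O'.div = O.div := by
  obtain ⟨u, p, hp, h⟩ := h
  rw [div_eq_of_isReversal_edges hp.2 h, add_sub_cancel_right]

theorem PathReversal.exists_div_eq [Finite E(G)] (h : PathReversal O O') :
    ∃ u v, O'.div = O.div + chip u - chip v := by
  obtain ⟨u, v, p, hp, h⟩ := h
  exact ⟨u, v, div_eq_of_isReversal_edges (hp.sublist (List.tail_sublist _)) h⟩

theorem CutReversal.linEquiv [Fintype V(G)] [Finite E(G)] (h : CutReversal O O') :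
    LinEquiv O.div O'.div := by
  obtain ⟨X, hX, h⟩ := h
  exact ⟨_, by rw [div_eq_of_isReversal_cut hX h, sub_sub_cancel]⟩

/-! ### Linear equivalence within a class -/

theorem linEquiv_of_eqvGen [Fintype V(G)] [Finite E(G)]
    {r : PartialOrientation G → PartialOrientation G → Prop}
    (hr : ∀ O O', r O O' → LinEquiv O.div O'.div) (h : Relation.EqvGen r O O') :
    LinEquiv O.div O'.div := by
  induction h with
  | rel _ _ h => exact hr _ _ h
  | refl => exact LinEquiv.refl _
  | symm _ _ _ ih => exact ih.symm
  | trans _ _ _ _ _ ih₁ ih₂ => exact ih₁.trans ih₂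

theorem linEquiv_of_cocycleSetoid [Fintype V(G)] [Finite E(G)] (h : (cocycleSetoid G).r O O') :
    LinEquiv O.div O'.div := by
  refine linEquiv_of_eqvGen (fun O O' h => ?_) h
  rcases h with h | h
  · rw [h.div_eq]
    exact LinEquiv.refl _
  · exact h.linEquiv

theorem linEquiv_of_cycleCocycleSetoid [Fintype V(G)] [Finite E(G)]
    (h : (cycleCocycleSetoid G).r O O') : LinEquiv O.div O'.div := by
  refine linEquiv_of_eqvGen (fun O O' h => ?_) h
  rcases h with h | h | h
  · rw [h.div_eq]
    exact LinEquiv.refl _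
  · exact h.linEquiv
  · rw [h.div_eq]
    exact LinEquiv.refl _

theorem cycleCocycleSetoid_of_cocycleSetoid (h : (cocycleSetoid G).r O O') :
    (cycleCocycleSetoid G).r O O' :=
  Relation.EqvGen.mono (fun _ _ h => Or.imp_right Or.inl h) _ _ h

/-! ### Constructing partial orientations -/

theorem exists_isReversal {S : Set E(G)} (h : ∀ e ∈ S, ∃ u v, O.Arc e u v) :
    ∃ O' : PartialOrientation G, O.IsReversal O' S := by
  classical
  choose t h hth using h
  refine ⟨⟨fun e => if he : e ∈ S then some (t e he) else O.head e, fun e v hv => ?_⟩,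
    fun e he => ?_, fun e he => dif_neg he⟩
  · split_ifs at hv with he
    · rw [← Option.some.inj hv]
      exact (hth e he).1.inc_left
    · exact O.inc e v hv
  · exact ⟨t e he, h e he, hth e he, (hth e he).1.symm, dif_pos he⟩

theorem exists_edgePivot {v : V(G)} {e f : E(G)} (he : O.head e = some v) (hf : O.head f = none)
    (hfv : G.Inc f v) : ∃ O' : PartialOrientation G, EdgePivot O O' ∧ O'.head f = some v ∧
      O'.head e = none ∧ (∀ a, a ≠ e → a ≠ f → O'.head a = O.head a) ∧
      ∀ a, ∀ w ≠ v, O'.head a = some w ↔ O.head a = some w := by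
  classical
  have hef : e ≠ f := by
    rintro rfl
    rw [he] at hf
    cases hf
  let O' : PartialOrientation G :=
    ⟨fun a => if a = f then some v else if a = e then none else O.head a, fun a w hw => by
      split_ifs at hw with h1 h2
      · rw [h1, ← Option.some.inj hw]
        exact hfv
      · exact O.inc a w hw⟩
  have h1 : O'.head f = some v := if_pos rfl
  have h2 : O'.head e = none := (if_neg hef).trans (if_pos rfl)
  have h3 (a : E(G)) (hae : a ≠ e) (haf : a ≠ f) : O'.head a = O.head a :=
    (if_neg haf).trans (if_neg hae)
  refine ⟨O', ⟨v, e, f, he, hf, hfv, h2, h1, h3⟩, h1, h2, h3, fun a w hw => ?_⟩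
  by_cases hae : a = e
  · rw [hae, h2, he]
    simp [hw.symm]
  by_cases haf : a = f
  · rw [haf, h1, hf]
    simp [hw.symm]
  rw [h3 a hae haf]

/-! ### Moves in the generalized cocycle reversal system -/

theorem EdgePivot.cocycleSetoid (h : EdgePivot O O') : (cocycleSetoid G).r O O' :=
  Relation.EqvGen.rel _ _ (Or.inl h)

theorem CutReversal.cocycleSetoid (h : CutReversal O O') : (cocycleSetoid G).r O O' :=
  Relation.EqvGen.rel _ _ (Or.inr h)

/-- By edge pivots at `v`, either all edges oriented towards `v` can be chosen in `T`, or all edges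
of `T` can be oriented towards `v`. -/
theorem exists_pivots [Finite E(G)] (O : PartialOrientation G) (v : V(G)) (T : Set E(G))
    (hT : ∀ e ∈ T, G.Inc e v ∧ (O.head e = none ∨ O.head e = some v)) :
    ∃ O' : PartialOrientation G, (cocycleSetoid G).r O O' ∧ O'.div = O.div ∧
      (∀ e, ∀ w ≠ v, O'.head e = some w ↔ O.head e = some w) ∧
      ({e | O'.head e = some v} ⊆ T ∨ T ⊆ {e | O'.head e = some v}) := by
  induction hn : ({e | O.head e = some v} \ T).ncard using Nat.strong_induction_on
    generalizing O with
  | _ n ih =>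
    by_cases h1 : {e | O.head e = some v} ⊆ T
    · exact ⟨O, (cocycleSetoid G).refl O, rfl, fun _ _ _ => Iff.rfl, Or.inl h1⟩
    by_cases h2 : T ⊆ {e | O.head e = some v}
    · exact ⟨O, (cocycleSetoid G).refl O, rfl, fun _ _ _ => Iff.rfl, Or.inr h2⟩
    obtain ⟨e, he, heT⟩ := Set.not_subset.1 h1
    obtain ⟨f, hfT, hf⟩ := Set.not_subset.1 h2
    have hf0 := (hT f hfT).2.resolve_right hf
    obtain ⟨O₁, hpiv, hf1, he1, ho1, hw1⟩ := exists_edgePivot he hf0 (hT f hfT).1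
    have hlt : ({a | O₁.head a = some v} \ T).ncard < n := by
      rw [← hn]
      refine Set.ncard_lt_ncard ⟨?_, fun hsub => ?_⟩ (Set.toFinite _)
      · rintro a ⟨ha, haT⟩
        refine ⟨?_, haT⟩
        rwa [Set.mem_ofPred_eq, ho1 a ?_ fun h => haT (h ▸ hfT)] at ha
        rintro rfl
        rw [he1] at ha
        cases ha
      · have := (hsub ⟨he, heT⟩).1
        rw [Set.mem_ofPred_eq, he1] at this
        cases this
    obtain ⟨O₂, hr, hdiv, hw2, h⟩ := ih _ hlt O₁ (fun a ha => ⟨(hT a ha).1, by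
      by_cases haf : a = f
      · exact Or.inr (haf ▸ hf1)
      · rw [ho1 a (fun h => heT (h ▸ ha)) haf]
        exact (hT a ha).2⟩) rfl
    exact ⟨O₂, (cocycleSetoid G).trans hpiv.cocycleSetoid hr, hdiv.trans hpiv.div_eq,
      fun a w hw => (hw2 a w hw).trans (hw1 a w hw), h⟩

/-- If every vertex outside `B` has more incoming edges than edges to `B`, then by edge pivots all
edges leaving `B` can be oriented away from `B`. -/
theorem exists_saturated [Fintype V(G)] [Finite E(G)] (O : PartialOrientation G) (B : Set V(G))
    (hB : ∀ e u v, O.Arc e u v → v ∈ B → u ∈ B) (hlt : ∀ v ∉ B, edgesTo G v B < O.indeg v) :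
    ∃ O' : PartialOrientation G, (cocycleSetoid G).r O O' ∧ O'.div = O.div ∧
      ∀ e : E(G), ∀ u ∈ B, ∀ v ∉ B, G.IsLink e u v → O'.head e = some v := by
  classical
  suffices key : ∀ U : Finset V(G), (∀ v ∈ U, v ∉ B) → ∃ O' : PartialOrientation G,
      (cocycleSetoid G).r O O' ∧ O'.div = O.div ∧
      (∀ e, ∀ w ∈ B, O'.head e = some w ↔ O.head e = some w) ∧
      ∀ e : E(G), ∀ u ∈ B, ∀ v ∈ U, G.IsLink e u v → O'.head e = some v by
    obtain ⟨O', hr, hdiv, -, h⟩ := key (Finset.univ.filter (· ∉ B)) (by simp)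
    exact ⟨O', hr, hdiv, fun e u hu v hv => h e u hu v (by simpa using hv)⟩
  intro U
  induction U using Finset.induction_on with
  | empty =>
    exact fun _ => ⟨O, (cocycleSetoid G).refl O, rfl, fun _ _ _ => Iff.rfl, by simp⟩
  | insert v U hvU ih =>
    intro hU
    obtain ⟨O₁, hr1, hdiv1, hw1, h1⟩ := ih fun w hw => hU w (Finset.mem_insert_of_mem hw)
    have hv := hU v (Finset.mem_insert_self v U)
    obtain ⟨O₂, hr2, hdiv2, hw2, h2⟩ := O₁.exists_pivots v {e : E(G) | ∃ u ∈ B, G.IsLink e v u} (by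
      rintro e ⟨u, hu, he⟩
      refine ⟨he.inc_left, ?_⟩
      rcases hx : O₁.head e with - | x
      · exact Or.inl rfl
      right
      rcases (O₁.inc e x hx).eq_or_eq_of_isLink he with h | h
      · rw [Subtype.ext h]
      · rw [Subtype.ext h, hw1 e u hu] at hx
        exact absurd (hB e v u ⟨he, hx⟩ hu) hv)
    have hsub : {e : E(G) | ∃ u ∈ B, G.IsLink e v u} ⊆ {e | O₂.head e = some v} := by
      rcases h2 with h2 | h2
      -- Pivots preserve the indegree of `v`, which is at least the size of the target set, so the
      -- inclusion would be an equality.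
      · refine (Set.eq_of_subset_of_ncard_le h2 ?_ (Set.toFinite _)).ge
        have h3 := congrFun (hdiv2.trans hdiv1) v
        have h4 := hlt v hv
        simp only [div, indeg, edgesTo] at h3 h4
        omega
      · exact h2
    refine ⟨O₂, (cocycleSetoid G).trans hr1 hr2, hdiv2.trans hdiv1, fun e w hw => ?_,
      fun e u hu w hw he => ?_⟩
    · rw [hw2 e w fun h => hv (h ▸ hw), hw1 e w hw]
    · by_cases hwv : w = v
      · subst hwv
        exact hsub ⟨u, hu, he.symm⟩
      · rw [hw2 e w hwv]
        exact h1 e u hu w (Finset.mem_of_mem_insert_of_ne hw hwv) he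

open Classical in
/-- Dhar's burning algorithm for partial orientations: a partial orientation is equivalent to an
acyclic one, or a set of vertices without sources can be fired without creating sources. -/
theorem exists_acyclic_or_fire [Fintype V(G)] [Finite E(G)] (O : PartialOrientation G) :
    (∃ O' : PartialOrientation G, (cocycleSetoid G).r O O' ∧ O'.Acyclic) ∨
    ∃ (O' : PartialOrientation G) (X : Set V(G)), (cocycleSetoid G).r O O' ∧ X.Nonempty ∧
      (∀ v ∈ X, 0 ≤ O.div v) ∧ (∀ v, 0 ≤ O.div v → 0 ≤ O'.div v) ∧
      O'.div = O.div - (laplacian G).mulVec (fun v => if v ∈ X then 1 else 0) := by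
  suffices key : ∀ (n : ℕ) (O₁ : PartialOrientation G) (B : Set V(G)) (ν : V(G) → ℕ),
      Bᶜ.ncard = n → (cocycleSetoid G).r O O₁ → O₁.div = O.div → (∀ v ∉ B, 0 ≤ O.div v) →
      (∀ e u v, O₁.Arc e u v → v ∈ B → u ∈ B ∧ ν u < ν v) →
      (∃ O' : PartialOrientation G, (cocycleSetoid G).r O O' ∧ O'.Acyclic) ∨
      ∃ (O' : PartialOrientation G) (X : Set V(G)), (cocycleSetoid G).r O O' ∧ X.Nonempty ∧
      (∀ v ∈ X, 0 ≤ O.div v) ∧ (∀ v, 0 ≤ O.div v → 0 ≤ O'.div v) ∧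
      O'.div = O.div - (laplacian G).mulVec (fun v => if v ∈ X then 1 else 0) by
    -- The fire starts at the sources; no arc enters them, so the invariant on arcs into `B` is
    -- vacuous.
    refine key _ O {v | O.div v < 0} 0 rfl ((cocycleSetoid G).refl O) rfl
      (fun v hv => not_lt.1 hv) fun e u v he hv => ?_
    exact absurd (div_nonneg_iff.2 ⟨e, he.2⟩) (not_le.2 hv)
  intro n
  induction n with
  | zero =>
    intro O₁ B ν hn hr _ _ hν
    rw [Set.ncard_eq_zero (Set.toFinite _), Set.compl_empty_iff] at hn
    exact Or.inl ⟨O₁, hr, acyclic_of_forall_arc_lt fun e u v he =>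
      (hν e u v he (hn ▸ Set.mem_univ v)).2⟩
  | succ n ih =>
    intro O₁ B ν hn hr hdiv hB hν
    by_cases hburn : ∃ v ∉ B, O₁.indeg v ≤ edgesTo G v B
    · obtain ⟨v, hv, hle⟩ := hburn
      obtain ⟨O₂, hr2, hdiv2, hw2, h2⟩ := O₁.exists_pivots v
        {e : E(G) | ∃ u ∈ B, G.IsLink e v u} (by
          rintro e ⟨u, hu, he⟩
          refine ⟨he.inc_left, ?_⟩
          rcases hx : O₁.head e with - | x
          · exact Or.inl rfl
          right
          rcases (O₁.inc e x hx).eq_or_eq_of_isLink he with h | h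
          · rw [Subtype.ext h]
          · rw [Subtype.ext h] at hx
            exact absurd (hν e v u ⟨he, hx⟩ hu).1 hv)
      have hsub : {e | O₂.head e = some v} ⊆ {e : E(G) | ∃ u ∈ B, G.IsLink e v u} := by
        rcases h2 with h2 | h2
        · exact h2
        · refine (Set.eq_of_subset_of_ncard_le h2 ?_ (Set.toFinite _)).ge
          have h3 := congrFun hdiv2 v
          simp only [div, indeg, edgesTo] at h3 hle
          omega
      -- All edges towards `v` now come from `B`, so `v` burns; its label exceeds all earlier ones.
      refine ih O₂ (insert v B) (Function.update ν v (∑ w, ν w + 1)) ?_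
        ((cocycleSetoid G).trans hr hr2) (hdiv2.trans hdiv)
        (fun w hw => hB w fun h => hw (Set.mem_insert_of_mem v h)) fun e a b he hb => ?_
      · have h3 : (insert v B)ᶜ = Bᶜ \ {v} := by
          ext w
          simp only [Set.mem_compl_iff, Set.mem_insert_iff, Set.mem_sdiff, Set.mem_singleton_iff]
          tauto
        rw [h3, Set.ncard_sdiff_singleton_of_mem (show v ∈ Bᶜ from hv), hn, Nat.add_sub_cancel]
      · have hne {w : V(G)} (hw : w ∈ B) : w ≠ v := fun h => hv (h ▸ hw)
        by_cases hbv : b = v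
        · subst hbv
          obtain ⟨u, hu, hl⟩ := hsub he.2
          have hau : u = a := he.tail_eq hl.symm rfl
          subst hau
          rw [Function.update_self, Function.update_of_ne (hne hu)]
          exact ⟨Set.mem_insert_of_mem _ hu, Nat.lt_succ_of_le
            (Finset.single_le_sum (f := ν) (fun _ _ => Nat.zero_le _) (Finset.mem_univ u))⟩
        · have hbB : b ∈ B := hb.resolve_left hbv
          obtain ⟨haB, hlt⟩ := hν e a b ⟨he.1, (hw2 e b hbv).1 he.2⟩ hbB
          rw [Function.update_of_ne hbv, Function.update_of_ne (hne haB)]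
          exact ⟨Set.mem_insert_of_mem _ haB, hlt⟩
    · push Not at hburn
      right
      -- The fire has stopped: each unburnt vertex has more incoming edges than edges to `B`, so it
      -- keeps one after the saturated cut is reversed.
      obtain ⟨O₂, hr2, hdiv2, hsat⟩ := O₁.exists_saturated B
        (fun e u v he hv => (hν e u v he hv).1) hburn
      have hcut {e : E(G)} (he : e ∈ cut G Bᶜ) : ∃ u ∈ B, ∃ v ∈ Bᶜ, O₂.Arc e u v := by
        obtain ⟨u, v, hu, hv, hl⟩ := he
        rw [Set.mem_compl_iff, not_not] at hu
        exact ⟨u, hu, v, hv, hl, hsat e u hu v hv hl⟩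
      obtain ⟨O₃, hrev⟩ := exists_isReversal (O := O₂) (S := cut G Bᶜ) fun e he => by
        obtain ⟨u, -, v, -, h⟩ := hcut he
        exact ⟨u, v, h⟩
      have hX : ∀ e ∈ cut G Bᶜ, ∃ v ∈ Bᶜ, O₂.head e = some v := fun e he => by
        obtain ⟨u, -, v, hv, h⟩ := hcut he
        exact ⟨v, hv, h.2⟩
      have hdiv3 := div_eq_of_isReversal_cut hX hrev
      rw [hdiv2, hdiv] at hdiv3
      have hr3 : (cocycleSetoid G).r O₂ O₃ := CutReversal.cocycleSetoid ⟨_, hX, hrev⟩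
      refine ⟨O₃, Bᶜ, (cocycleSetoid G).trans hr ((cocycleSetoid G).trans hr2 hr3),
        (Set.ncard_pos (Set.toFinite _)).1 (by omega), hB, fun v hv => ?_, hdiv3⟩
      rw [hdiv3, Pi.sub_apply, laplacian_mulVec_indicator]
      split_ifs with hvB
      · have h3 := hburn v hvB
        rw [← hdiv, div, compl_compl]
        omega
      · omega

/-- A partial orientation is equivalent to an acyclic one or to a sourceless one. -/
theorem exists_acyclic_or_div_nonneg [Fintype V(G)] [Finite E(G)] [G.Loopless]
    (hG : G.toSimpleGraph.Connected) (O : PartialOrientation G) :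
    (∃ O' : PartialOrientation G, (cocycleSetoid G).r O O' ∧ O'.Acyclic) ∨
    ∃ O' : PartialOrientation G, (cocycleSetoid G).r O O' ∧ 0 ≤ O'.div := by
  classical
  by_contra! hcon
  obtain ⟨hacyc, hsource⟩ := hcon
  obtain ⟨O₁, hr1, hmin⟩ : ∃ O₁ : PartialOrientation G, (cocycleSetoid G).r O O₁ ∧
      ∀ O₂ : PartialOrientation G, (cocycleSetoid G).r O O₂ →
        {v | O₁.div v < 0}.ncard ≤ {v | O₂.div v < 0}.ncard := by
    obtain ⟨O₁, hr1, hmin⟩ := WellFounded.has_min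
      (measure fun O₁ : PartialOrientation G => {v | O₁.div v < 0}.ncard).wf
      {O₁ | (cocycleSetoid G).r O O₁} ⟨O, (cocycleSetoid G).refl O⟩
    exact ⟨O₁, hr1, fun O₂ hr2 => not_lt.1 (hmin O₂ hr2)⟩
  obtain ⟨q, hq⟩ : ∃ q, O₁.div q < 0 := by
    by_contra! hpos
    exact hsource O₁ hr1 fun v => hpos v
  -- The `+ 1` is there because the divisor of an orientation is at least -1 everywhere. The bound
  -- allows firing as often as possible while keeping `q` fixed and creating no source.
  obtain ⟨C, hC⟩ := exists_bound_of_laplacian_mulVec_le hG q (O₁.div + 1)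
  obtain ⟨z, ⟨f, O₂, hr2, hfq, hdiv2, hpos2, rfl⟩, hmax⟩ := Int.exists_greatest_of_bdd
    (P := fun z => ∃ (f : V(G) → ℤ) (O₂ : PartialOrientation G), (cocycleSetoid G).r O O₂ ∧
      f q = 0 ∧ O₂.div = O₁.div - (laplacian G).mulVec f ∧
      (∀ v, 0 ≤ O₁.div v → 0 ≤ O₂.div v) ∧ ∑ v, f v = z)
    ⟨C, by
      rintro z ⟨f, O₂, -, hfq, hdiv2, -, rfl⟩
      refine hC f hfq fun v _ => ?_
      have h1 := O₂.neg_one_le_div v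
      rw [hdiv2, Pi.sub_apply] at h1
      rw [Pi.add_apply, Pi.one_apply]
      omega⟩
    ⟨_, 0, O₁, hr1, rfl, by simp, fun _ h => h, rfl⟩
  -- The sources of `O₂` are among those of `O₁`, so losing `q` would contradict minimality. Hence
  -- the next fired set avoids `q`, against maximality of the script.
  have hq2 : O₂.div q < 0 := by
    by_contra hq2
    refine (hmin O₂ hr2).not_gt (Set.ncard_lt_ncard ⟨fun v hv => ?_, fun hsub => ?_⟩
      (Set.toFinite _))
    · exact not_le.1 fun h => (not_le.2 hv) (hpos2 v h)
    · exact hq2 (hsub hq)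
  rcases O₂.exists_acyclic_or_fire with ⟨O₃, hr3, h3⟩ | ⟨O₃, X, hr3, ⟨x, hx⟩, hX, hpos3, hdiv3⟩
  · exact hacyc O₃ ((cocycleSetoid G).trans hr2 hr3) h3
  have hqX : q ∉ X := fun h => (hX q h).not_gt hq2
  have hle := hmax _ ⟨f + fun u => if u ∈ X then (1 : ℤ) else 0, O₃,
    (cocycleSetoid G).trans hr2 hr3, by simp [hfq, hqX], by
      rw [hdiv3, hdiv2, Matrix.mulVec_add, sub_sub], fun v hv => hpos3 v (hpos2 v hv), rfl⟩
  simp only [Pi.add_apply, Finset.sum_add_distrib] at hle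
  have := Finset.single_le_sum (f := fun u => if u ∈ X then (1 : ℤ) else 0)
    (fun u _ => by split_ifs <;> simp) (Finset.mem_univ x)
  rw [if_pos hx] at this
  omega

/-- If all vertices outside `X` are non-sources and `X` is reachable from `u` inside `X`, then
there is an equivalent partial orientation in which all vertices are reachable from `u`. -/
theorem exists_reachable [Fintype V(G)] [Finite E(G)] [G.Loopless]
    (hG : G.toSimpleGraph.Connected) (u : V(G)) (n : ℕ) (O : PartialOrientation G)
    (X : Set V(G)) (hn : Xᶜ.ncard = n) (huX : u ∈ X) (hX : ∀ v ∉ X, ∃ e, O.head e = some v)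
    (hreach : ∀ x ∈ X, Relation.ReflTransGen (fun a b => a ∈ X ∧ b ∈ X ∧ ∃ e, O.Arc e a b) u x) :
    ∃ O' : PartialOrientation G, (cocycleSetoid G).r O O' ∧
      ∀ x, Relation.ReflTransGen (fun a b => ∃ e, O'.Arc e a b) u x := by
  induction n generalizing O X with
  | zero =>
    rw [Set.ncard_eq_zero (Set.toFinite _), Set.compl_empty_iff] at hn
    subst hn
    exact ⟨O, (cocycleSetoid G).refl O, fun x =>
      Relation.ReflTransGen.mono (fun _ _ h => h.2.2) _ _ (hreach x trivial)⟩
  | succ n ih =>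
    -- Once an arc leaves `X`, its head joins `X`. Only arcs inside `X` and incoming edges of the
    -- other outside vertices need survive; vertices in `X` may become sources.
    have step (O₁ : PartialOrientation G) (hr1 : (cocycleSetoid G).r O O₁) (e : E(G))
        (x y : V(G)) (hx : x ∈ X) (hy : y ∉ X) (he : O₁.Arc e x y)
        (hX1 : ∀ v ∉ X, v ≠ y → ∃ e, O₁.head e = some v)
        (hreach1 : ∀ e, ∀ a ∈ X, ∀ b ∈ X, O.Arc e a b → O₁.Arc e a b) :
        ∃ O' : PartialOrientation G, (cocycleSetoid G).r O O' ∧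
          ∀ x, Relation.ReflTransGen (fun a b => ∃ e, O'.Arc e a b) u x := by
      have hreach2 (z : V(G)) (hz : z ∈ X) : Relation.ReflTransGen
          (fun a b => a ∈ insert y X ∧ b ∈ insert y X ∧ ∃ e, O₁.Arc e a b) u z := by
        refine Relation.ReflTransGen.mono ?_ _ _ (hreach z hz)
        rintro a b ⟨ha, hb, e, he⟩
        exact ⟨Or.inr ha, Or.inr hb, e, hreach1 e a ha b hb he⟩
      have hcompl : (insert y X)ᶜ = Xᶜ \ {y} := by
        ext w
        simp only [Set.mem_compl_iff, Set.mem_insert_iff, Set.mem_sdiff, Set.mem_singleton_iff]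
        tauto
      have hcard : (insert y X)ᶜ.ncard = n := by
        rw [hcompl, Set.ncard_sdiff_singleton_of_mem (show y ∈ Xᶜ from hy), hn,
          Nat.add_sub_cancel]
      obtain ⟨O', hr', h'⟩ := ih O₁ (insert y X) hcard (Or.inr huX)
        (fun v hv => hX1 v (fun h => hv (Or.inr h)) fun h => hv (Or.inl h)) (by
          rintro z (rfl | hz)
          · exact (hreach2 x hx).tail ⟨Or.inr hx, Or.inl rfl, e, he⟩
          · exact hreach2 z hz)
      exact ⟨O', (cocycleSetoid G).trans hr1 hr', h'⟩
    obtain ⟨e, x, y, hx, hy, hl⟩ : ∃ (e : E(G)) (x y : V(G)), x ∈ X ∧ y ∉ X ∧ G.IsLink e x y := by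
      obtain ⟨z, hz⟩ := (Set.ncard_pos (Set.toFinite Xᶜ)).1 (by omega)
      obtain ⟨p⟩ := hG.preconnected u z
      obtain ⟨d, -, hd1, hd2⟩ := p.exists_boundary_dart X huX hz
      obtain ⟨e, he⟩ := (G.toSimpleGraph_adj_iff _ _).1 d.adj
      exact ⟨⟨e, he.edge_mem⟩, _, _, hd1, hd2, he⟩
    -- If the whole cut points into `X`, reverse it. Otherwise some cut edge already points
    -- outwards, or it is unoriented and a pivot at its outer end makes it do so.
    by_cases hsat : ∀ e ∈ cut G X, ∃ v ∈ X, O.head e = some v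
    · have harc (e : E(G)) (x y : V(G)) (hx : x ∈ X) (hy : y ∉ X) (hl : G.IsLink e x y) :
          O.Arc e y x := by
        obtain ⟨v, hv, hev⟩ := hsat e ⟨y, x, hy, hx, hl.symm⟩
        rcases (O.inc e v hev).eq_or_eq_of_isLink hl with h | h
        · rw [Subtype.ext h] at hev
          exact ⟨hl.symm, hev⟩
        · exact absurd (Subtype.ext h ▸ hv) hy
      obtain ⟨O₁, hrev⟩ := exists_isReversal (O := O) (S := cut G X) fun e he => by
        obtain ⟨y, x, hy, hx, hl⟩ := he
        exact ⟨y, x, harc e x y hx hy hl.symm⟩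
      refine step O₁ (CutReversal.cocycleSetoid ⟨X, hsat, hrev⟩) e x y hx hy ?_
        (fun v hv _ => ?_) fun g a ha b hb hab => ?_
      · obtain ⟨a, b, hab, hba⟩ := hrev.1 e ⟨y, x, hy, hx, hl.symm⟩
        have h1 := harc e x y hx hy hl
        have hbx : b = x := by simpa [hab.2] using h1.2
        have hay : a = y := h1.tail_eq hab.1 hbx
        exact ⟨hl, hay ▸ hba.2⟩
      · obtain ⟨g, hg⟩ := hX v hv
        refine ⟨g, (hrev.2 g fun hcut => ?_).trans hg⟩
        obtain ⟨w, hw, hgw⟩ := hsat g hcut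
        rw [hg, Option.some.injEq] at hgw
        exact hv (hgw ▸ hw)
      · refine ⟨hab.1, (hrev.2 g ?_).trans hab.2⟩
        rintro ⟨c, d, hc, hd, hcd⟩
        rcases hcd.eq_and_eq_or_eq_and_eq hab.1 with ⟨h1, -⟩ | ⟨h1, -⟩
        · exact hc (Subtype.ext h1 ▸ ha)
        · exact hc (Subtype.ext h1 ▸ hb)
    · push Not at hsat
      obtain ⟨f, ⟨y, x, hy, hx, hl⟩, hf⟩ := hsat
      rcases hfv : O.head f with - | w
      · obtain ⟨g, hg⟩ := hX y hy
        obtain ⟨O₁, hpiv, hf1, -, -, hw1⟩ := exists_edgePivot hg hfv hl.inc_left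
        refine step O₁ hpiv.cocycleSetoid f x y hx hy ⟨hl.symm, hf1⟩ (fun v hv hvy => ?_)
          fun e a ha b hb hab => ⟨hab.1, (hw1 e b fun h => hy (h ▸ hb)).2 hab.2⟩
        obtain ⟨e, he⟩ := hX v hv
        exact ⟨e, (hw1 e v hvy).2 he⟩
      · rcases (O.inc f w hfv).eq_or_eq_of_isLink hl with h | h
        · rw [Subtype.ext h] at hfv
          exact step O ((cocycleSetoid G).refl O) f x y hx hy ⟨hl.symm, hfv⟩
            (fun v hv _ => hX v hv) fun _ _ _ _ _ h => h
        · exact absurd hfv (hf w (Subtype.ext h ▸ hx))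

/-- If `O` is sourceless, then a chip can be moved from `v` to `u` by a directed path reversal of
an equivalent partial orientation. -/
theorem exists_pathReversal [Fintype V(G)] [Finite E(G)] [G.Loopless]
    (hG : G.toSimpleGraph.Connected) (hO : 0 ≤ O.div) (u v : V(G)) :
    ∃ O₁ O₂ : PartialOrientation G, (cocycleSetoid G).r O O₁ ∧ PathReversal O₁ O₂ ∧
      O₂.div = O₁.div + chip u - chip v := by
  obtain ⟨O₁, hr, hreach⟩ := exists_reachable hG u _ O {u} rfl rfl
    (fun w _ => div_nonneg_iff.1 (hO w)) (by
      rintro x rfl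
      exact Relation.ReflTransGen.refl)
  obtain ⟨p, hp⟩ := DirWalk.exists_isPath_of_reflTransGen (hreach v)
  obtain ⟨O₂, hrev⟩ := exists_isReversal (O := O₁) (S := {e | e ∈ p.edges}) fun e he =>
    DirWalk.exists_arc_of_mem_edges he
  exact ⟨O₁, O₂, hr, ⟨u, v, p, hp, hrev⟩,
    div_eq_of_isReversal_edges (hp.sublist (List.tail_sublist _)) hrev⟩

/-! ### Distances in the auxiliary graph -/

section AuxGraph

variable [Fintype V(G)] [Finite E(G)] {s : Setoid (PartialOrientation G)} {k : ℤ}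

/-- The rank descends to classes, and each edge of the walk costs at most one, whichever end the
path reversal starts from. -/
theorem rank_le_rank_add_length [Nonempty V(G)]
    (hs : ∀ O O', s.r O O' → LinEquiv O.div O'.div) {c t : ClassOfDeg s k}
    (w : (auxGraph s k).Walk c t) {O O' : PartialOrientation G} (hO : Quotient.mk s O = c.1)
    (hO' : Quotient.mk s O' = t.1) : rank O.div ≤ rank O'.div + w.length := by
  have hrank {O O' : PartialOrientation G} (h : Quotient.mk s O = Quotient.mk s O') :
      rank O.div = rank O'.div := (hs _ _ (Quotient.exact h)).rank_eq
  induction w generalizing O with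
  | nil => simp [hrank (hO.trans hO'.symm)]
  | cons hadj w ih =>
    rw [SimpleGraph.Walk.length_cons, Nat.cast_add, Nat.cast_one]
    rw [auxGraph, SimpleGraph.fromRel_adj] at hadj
    obtain ⟨-, ⟨O₁, O₂, h1, h2, hp⟩ | ⟨O₁, O₂, h1, h2, hp⟩⟩ := hadj
    · obtain ⟨u, v, huv⟩ := hp.exists_div_eq
      have h3 := ih h2 hO'
      have h4 := rank_sub_one_le_rank_add_chip_sub_chip O₁.div u v
      rw [← huv, ← hrank (hO.trans h1.symm)] at h4
      linarith
    · obtain ⟨u, v, huv⟩ := hp.exists_div_eq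
      have h3 := ih h1 hO'
      have h4 := rank_sub_one_le_rank_add_chip_sub_chip O₂.div v u
      rw [huv, sub_add_cancel, add_sub_cancel_right, ← huv, ← hrank (hO.trans h2.symm)] at h4
      linarith

/-- Induction on rank plus one: the rank-lowering chip move for `O.div` is carried out on an
equivalent sourceless orientation, as adding and removing chips respects linear equivalence. -/
theorem exists_edist_le [G.Loopless] (hG : G.toSimpleGraph.Connected)
    (hs : ∀ O O', s.r O O' → LinEquiv O.div O'.div)
    (hs' : ∀ O O', (cocycleSetoid G).r O O' → s.r O O') (n : ℕ) (O : PartialOrientation G)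
    (hO : O.div.deg = k) (hn : rank O.div + 1 = n) :
    ∃ t ∈ acyclicClasses s k, (auxGraph s k).edist (toClass s O hO) t ≤ n := by
  have := hG.nonempty
  have hwin {O' : PartialOrientation G} (h : (cocycleSetoid G).r O O') :
      LinEquiv O.div O'.div := linEquiv_of_cocycleSetoid h
  induction n generalizing O with
  | zero =>
    have hO1 : ¬ Winnable O.div := rank_eq_neg_one_iff.1 (by push_cast at hn; omega)
    rcases O.exists_acyclic_or_div_nonneg hG with ⟨O', hr, hO'⟩ | ⟨O', hr, hO'⟩
    · exact ⟨toClass s O hO, ⟨O', (Quotient.sound (hs' _ _ hr)).symm, hO'⟩, by simp⟩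
    · exact absurd ⟨O'.div, hO', hwin hr⟩ hO1
  | succ n ih =>
    push_cast at hn
    obtain ⟨u, v, huv⟩ := exists_rank_add_chip_sub_chip hG (D := O.div) (by omega) deg_div_le
    rcases O.exists_acyclic_or_div_nonneg hG with ⟨O', hr, hO'⟩ | ⟨O', hr, hO'⟩
    · have h1 := rank_eq_neg_one_iff.2 hO'.not_winnable
      rw [← (hwin hr).rank_eq] at h1
      omega
    obtain ⟨O₁, O₂, hr1, hp, hdiv⟩ := exists_pathReversal hG hO' u v
    have hr01 := (cocycleSetoid G).trans hr hr1
    have hequiv : LinEquiv (O.div + chip u - chip v) O₂.div := by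
      rw [hdiv]
      exact ((hwin hr01).add_right _).sub_right _
    have hdeg : O₂.div.deg = k := by
      rw [← hequiv.deg_eq, Divisor.deg_sub, Divisor.deg_add, deg_chip, deg_chip, hO,
        add_sub_cancel_right]
    have hrank : rank O₂.div = rank O.div - 1 := by rw [← hequiv.rank_eq, huv]
    obtain ⟨t, ht, hle⟩ := ih O₂ hdeg (by omega) linEquiv_of_cocycleSetoid
    refine ⟨t, ht, SimpleGraph.edist_triangle.trans
      ((add_le_add (SimpleGraph.edist_le_one_iff_adj_or_eq.2 (Or.inl ?_)) hle).trans ?_)⟩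
    · refine (SimpleGraph.fromRel_adj _ _ _).2 ⟨fun h => ?_, Or.inl ⟨O₁, O₂, ?_, rfl, hp⟩⟩
      -- The two classes are distinct because their ranks differ.
      · have := (hs _ _ (Quotient.exact (congrArg Subtype.val h))).rank_eq
        omega
      · exact (Quotient.sound (hs' _ _ hr01)).symm
    · push_cast
      rw [add_comm]

theorem setDist_eq_rank_add_one [G.Loopless] (hG : G.toSimpleGraph.Connected)
    (hs : ∀ O O', s.r O O' → LinEquiv O.div O'.div)
    (hs' : ∀ O O', (cocycleSetoid G).r O O' → s.r O O') (O : PartialOrientation G)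
    (hO : O.div.deg = k) :
    ∃ d : ℕ, setDist (auxGraph s k) {toClass s O hO} (acyclicClasses s k) = d ∧
      rank O.div = (d : ℤ) - 1 := by
  have := hG.nonempty
  obtain ⟨d, hd⟩ := Int.eq_ofNat_of_zero_le (a := rank O.div + 1)
    (by have := neg_one_le_rank O.div; omega)
  refine ⟨d, le_antisymm ?_ ?_, by omega⟩
  · obtain ⟨t, ht, hle⟩ := exists_edist_le hG hs hs' d O hO hd
    exact (iInf₂_le _ (Set.mem_singleton _)).trans ((iInf₂_le t ht).trans hle)
  · refine le_iInf₂ fun c hc => le_iInf₂ fun t ht => le_iInf fun w => ?_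
    rw [Set.mem_singleton_iff] at hc
    subst hc
    obtain ⟨O', hO't, hO'⟩ := ht
    have h1 := rank_le_rank_add_length hs w rfl hO't
    rw [rank_eq_neg_one_iff.2 hO'.not_winnable] at h1
    exact_mod_cast (show d ≤ w.length by omega)

end AuxGraph

end PartialOrientation

end ReversalSystem

open ReversalSystem PartialOrientation in
theorem theorem5 {α β : Type*} (G : Graph α β) [Fintype V(G)] [Finite E(G)] [G.Loopless]
    (hG : G.toSimpleGraph.Connected) (k : ℤ) (O : PartialOrientation G) (hO : O.div.deg = k) :
    (∃ d : ℕ, setDist (auxGraph (cycleCocycleSetoid G) k) {toClass (cycleCocycleSetoid G) O hO}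
        (acyclicClasses (cycleCocycleSetoid G) k) = d ∧ rank O.div = (d : ℤ) - 1) ∧
    (∃ d : ℕ, setDist (auxGraph (cocycleSetoid G) k) {toClass (cocycleSetoid G) O hO}
        (acyclicClasses (cocycleSetoid G) k) = d ∧ rank O.div = (d : ℤ) - 1) :=
  ⟨setDist_eq_rank_add_one hG (fun _ _ => linEquiv_of_cycleCocycleSetoid)
    (fun _ _ => cycleCocycleSetoid_of_cocycleSetoid) O hO,
  setDist_eq_rank_add_one hG (fun _ _ => linEquiv_of_cocycleSetoid) (fun _ _ => id) O hO⟩
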